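/- Let $(H_1,H_0,\Psi,\Phi)$ be a crossed module of (finite-dimensional, real) Lie groups: $\Psi:H_1\to H_0$ is a Lie group morphism and $\Phi$ is a smooth action of $H_0$ on $H_1$ by group automorphisms with $\Psi(\Phi_g(h))=g\Psi(h)g^{-1}$ and $\Phi_{\Psi(h)}(h')=hh'h^{-1}$; it encodes a strict Lie 2-group $\Gamma$. Let $\mathfrak h_1,\mathfrak h_0$ be the Lie algebras of $H_1,H_0$, let $\mathfrak l_1=d\Psi_1:\mathfrak h_1\to\mathfrak h_0$, let $\mathfrak l_2(u,v)=[u,v]$ for $u,v\in\mathfrak h_0$, and let $\mathfrak l_2(u,m)$, for $u\in\mathfrak h_0$, $m\in\mathfrak h_1$, be the infinitesimal action, i.e. the derivative at $g=1$ in direction $u$ of $g\mapsto(\Phi_g)_*m$, where $(\Phi_g)_*=d(\Phi_g)_1:\mathfrak h_1\to\mathfrak h_1$. Suppose that this strict Lie 2-algebra is quadratic: there is given a nondegenerate pairing $\mathcal S:\mathfrak h_0\times\mathfrak h_1\to\mathbb R$ (extended to a graded symmetric bilinear form of degree 1 on $\mathfrak h_1\oplus\mathfrak h_0$) with $$\mathcal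 S(\mathfrak l_1(m),p)=\mathcal S(\mathfrak l_1(p),m),\qquad \mathcal S(\mathfrak l_2(u,v),m)+\mathcal S(v,\mathfrak l_2(u,m))=0$$ for all $u,v\in\mathfrak h_0$, $m,p\in\mathfrak h_1$. Suppose also that every connected component of $H_0$ contains an element $g$ with $\mathcal S(\mathrm{Ad}_gu,(\Phi_g)_*m)=\mathcal S(u,m)$ for all $u,m$ (this holds automatically, with $g=1$, if $H_0$ is connected). A $\Gamma$-connection on a smooth manifold $M$ is a pair $(A,B)$ with $A\in\Omega^1(M,\mathfrak h_0)$ and $B\in\Omega^2(M,\mathfrak h_1)$. Put $$\mathsf{curv}(A,B)=dB+\mathfrak l_2(A,B)\in\Omega^3(M,\mathfrak h_1),\qquad \mathsf{fcurv}(A,B)=dA+\tfrac12\mathfrak l_2(A,A)-\mathfrak l_1(B)\in\Omega^2(M,\mathfrak h_0).$$ Here, for a bilinear map $b$, a $k$-form $\alpha$ and an $l$-form $\beta$, $b(\alpha,\beta)(X_1,\dots,X_{k+l})=\frac1{k!\,l!}\sum_{\tau\in S_{k+l}}\mathrm{sgn}(\tau)\,b\big(\alpha(X_{\tau(1)},\dots,X_{\tau(k)}),\beta(X_{\tau(k+1)},\dots,X_{\tau(k+l)})\big)$.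 Let $\bar\theta$ be the right-invariant Maurer-Cartan form of $H_0$. Two $\Gamma$-connections $(A,B)$ and $(A',B')$ are gauge equivalent if there are a smooth map $g:M\to H_0$ and a 1-form $\phi\in\Omega^1(M,\mathfrak h_1)$ with $$A'=\mathrm{Ad}_gA-g^*\bar\theta-\mathfrak l_1(\phi),$$ $$B'=(\Phi_g)_*B-d\phi+\tfrac12\mathfrak l_2(\mathfrak l_1(\phi),\phi)-\mathfrak l_2(\mathrm{Ad}_gA,\phi)+\mathfrak l_2(g^*\bar\theta,\phi).$$ If $(A,B)$ and $(A',B')$ are gauge equivalent $\Gamma$-connections on $M$, then, as 5-forms on $M$, $$\mathcal S(\mathsf{fcurv}(A',B'),\mathsf{curv}(A',B'))=\mathcal S(\mathsf{fcurv}(A,B),\mathsf{curv}(A,B)).$$ -/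

import Mathlib

open scoped Manifold ContDiff

noncomputable section

/-! ## Vector-valued differential forms on a manifold -/

section Forms

/-- The bilinear evaluation `(v₁, …, v_{k+l}) ↦ b (α (v₁, …, v_k)) (β (v_{k+1}, …, v_{k+l}))`
as a continuous multilinear map. -/
def formTensor {T V W U : Type*}
    [AddCommGroup T] [Module ℝ T] [TopologicalSpace T]
    [NormedAddCommGroup V] [NormedSpace ℝ V] [NormedAddCommGroup W] [NormedSpace ℝ W]
    [NormedAddCommGroup U] [NormedSpace ℝ U] {k l : ℕ}
    (b : V →L[ℝ] W →L[ℝ] U) (α : T [⋀^Fin k]→L[ℝ] V) (β : T [⋀^Fin l]→L[ℝ] W) :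
    ContinuousMultilinearMap ℝ (fun _ : Fin (k + l) => T) U where
  toFun v := b (α fun i => v (Fin.castAdd l i)) (β fun j => v (Fin.natAdd k j))
  map_update_add' := by
    intro _ v i x y
    obtain rfl : ‹DecidableEq (Fin (k + l))› = instDecidableEqFin _ := Subsingleton.elim _ _
    induction i using Fin.addCases with
    | left i =>
      have h1 : ∀ z, (fun j => Function.update v (Fin.castAdd l i) z (Fin.castAdd l j))
          = Function.update (fun j => v (Fin.castAdd l j)) i z := fun z =>
        Function.update_comp_eq_of_injective v (Fin.castAdd_injective k l) i z
      have h2 : ∀ z, (fun j => Function.update v (Fin.castAdd l i) z (Fin.natAdd k j))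
          = fun j => v (Fin.natAdd k j) := fun z => by
        funext j
        exact Function.update_of_ne (by simp [Fin.ext_iff]; omega) _ _
      simp [h1, h2]
    | right i =>
      have h1 : ∀ z, (fun j => Function.update v (Fin.natAdd k i) z (Fin.natAdd k j))
          = Function.update (fun j => v (Fin.natAdd k j)) i z := fun z =>
        Function.update_comp_eq_of_injective v (Fin.natAdd_injective l k) i z
      have h2 : ∀ z, (fun j => Function.update v (Fin.natAdd k i) z (Fin.castAdd l j))
          = fun j => v (Fin.castAdd l j) := fun z => by
        funext j
        exact Function.update_of_ne (by simp [Fin.ext_iff]; omega) _ _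
      simp [h1, h2]
  map_update_smul' := by
    intro _ v i c x
    obtain rfl : ‹DecidableEq (Fin (k + l))› = instDecidableEqFin _ := Subsingleton.elim _ _
    induction i using Fin.addCases with
    | left i =>
      have h1 : ∀ z, (fun j => Function.update v (Fin.castAdd l i) z (Fin.castAdd l j))
          = Function.update (fun j => v (Fin.castAdd l j)) i z := fun z =>
        Function.update_comp_eq_of_injective v (Fin.castAdd_injective k l) i z
      have h2 : ∀ z, (fun j => Function.update v (Fin.castAdd l i) z (Fin.natAdd k j))
          = fun j => v (Fin.natAdd k j) := fun z => by
        funext j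
        exact Function.update_of_ne (by simp [Fin.ext_iff]; omega) _ _
      simp [h1, h2]
    | right i =>
      have h1 : ∀ z, (fun j => Function.update v (Fin.natAdd k i) z (Fin.natAdd k j))
          = Function.update (fun j => v (Fin.natAdd k j)) i z := fun z =>
        Function.update_comp_eq_of_injective v (Fin.natAdd_injective l k) i z
      have h2 : ∀ z, (fun j => Function.update v (Fin.natAdd k i) z (Fin.castAdd l j))
          = fun j => v (Fin.castAdd l j) := fun z => by
        funext j
        exact Function.update_of_ne (by simp [Fin.ext_iff]; omega) _ _
      simp [h1, h2]
  cont := by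
    have hα : Continuous fun v : Fin (k + l) → T => α fun i => v (Fin.castAdd l i) :=
      α.cont.comp (by fun_prop)
    have hβ : Continuous fun v : Fin (k + l) → T => β fun j => v (Fin.natAdd k j) :=
      β.cont.comp (by fun_prop)
    exact (b.continuous.comp hα).clm_apply hβ

/-- The wedge product of vector-valued alternating maps along a bilinear map `b`:
`b(α, β)(v₁, …, v_{k+l}) = 1/(k! l!) ∑_σ sgn σ • b (α (v_{σ 1}, …)) (β (v_{σ (k+1)}, …))`. -/
def altWedge {T V W U : Type*}
    [AddCommGroup T] [Module ℝ T] [TopologicalSpace T]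
    [NormedAddCommGroup V] [NormedSpace ℝ V] [NormedAddCommGroup W] [NormedSpace ℝ W]
    [NormedAddCommGroup U] [NormedSpace ℝ U] {k l : ℕ}
    (b : V →L[ℝ] W →L[ℝ] U) (α : T [⋀^Fin k]→L[ℝ] V) (β : T [⋀^Fin l]→L[ℝ] W) :
    T [⋀^Fin (k + l)]→L[ℝ] U :=
  ((k.factorial : ℝ) * (l.factorial : ℝ))⁻¹ • ContinuousMultilinearMap.alternatization (formTensor b α β)

variable {E M : Type*} [NormedAddCommGroup E] [NormedSpace ℝ E]
  [TopologicalSpace M] [ChartedSpace E M]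
  {V W U : Type*} [NormedAddCommGroup V] [NormedSpace ℝ V]
  [NormedAddCommGroup W] [NormedSpace ℝ W] [NormedAddCommGroup U] [NormedSpace ℝ U] {k l : ℕ}

variable (E M V k) in
/-- `V`-valued `k`-forms on `M`, with no smoothness required. -/
abbrev DForm : Type _ := (x : M) → TangentSpace 𝓘(ℝ, E) x [⋀^Fin k]→L[ℝ] V

/-- The expression of a form in the chart at `x₀`: its pullback by the inverse of the chart. -/
def DForm.inChart (α : DForm E M V k) (x₀ : M) : E → E [⋀^Fin k]→L[ℝ] V := fun y =>
  (α ((extChartAt 𝓘(ℝ, E) x₀).symm y)).compContinuousLinearMap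
    (mfderiv 𝓘(ℝ, E) 𝓘(ℝ, E) (extChartAt 𝓘(ℝ, E) x₀).symm y)

/-- A form is smooth if it is smooth in every preferred chart. -/
def DForm.IsSmooth (α : DForm E M V k) : Prop :=
  ∀ x₀ : M, ContDiffOn ℝ ∞ (α.inChart x₀) (extChartAt 𝓘(ℝ, E) x₀).target

/-- The exterior derivative, computed at `x` in the chart at `x`. -/
def DForm.d (α : DForm E M V k) : DForm E M V (k + 1) := fun x =>
  (extDeriv (α.inChart x) (extChartAt 𝓘(ℝ, E) x x)).compContinuousLinearMap
    (mfderiv 𝓘(ℝ, E) 𝓘(ℝ, E) (extChartAt 𝓘(ℝ, E) x) x)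

/-- The pointwise wedge product `b(α, β)` of forms along a bilinear map of the values. -/
def DForm.wedge (b : V →L[ℝ] W →L[ℝ] U) (α : DForm E M V k) (β : DForm E M W l) :
    DForm E M U (k + l) := fun x => altWedge b (α x) (β x)

/-- Application of a (point-dependent) linear map of the values to a form. -/
def DForm.map (f : M → V →L[ℝ] W) (α : DForm E M V k) : DForm E M W k := fun x =>
  (f x).compContinuousAlternatingMap (α x)

end Forms

/-! ## Lie groups: norms on the Lie algebra, adjoint action, Maurer-Cartan form -/

section LieGroups

variable {E G : Type*} [NormedAddCommGroup E] [NormedSpace ℝ E]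
  [TopologicalSpace G] [ChartedSpace E G] [Group G]

/-- A norm on the Lie algebra, inducing its usual topology. -/
instance instNormedAddCommGroupLieAlg : NormedAddCommGroup (GroupLieAlgebra 𝓘(ℝ, E) G) where
  toAddCommGroup := inferInstance
  toMetricSpace := MetricSpace.replaceTopology
    (U := (inferInstance : TopologicalSpace (GroupLieAlgebra 𝓘(ℝ, E) G)))
    (inferInstanceAs (MetricSpace E)) rfl
  norm := fun v => norm (E := E) v
  dist_eq := fun v w => NormedAddCommGroup.dist_eq (E := E) v w

instance instNormedSpaceLieAlg : NormedSpace ℝ (GroupLieAlgebra 𝓘(ℝ, E) G) where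
  toModule := inferInstance
  norm_smul_le := fun c v => norm_smul_le (β := E) c v

instance instFiniteDimensionalLieAlg [FiniteDimensional ℝ E] :
    FiniteDimensional ℝ (GroupLieAlgebra 𝓘(ℝ, E) G) :=
  inferInstanceAs (FiniteDimensional ℝ E)

variable (E G) in
/-- The Lie bracket of the Lie algebra of `G` as a continuous bilinear map. -/
def lieBracketCLM [FiniteDimensional ℝ E] [LieGroup 𝓘(ℝ, E) ∞ G] :
    GroupLieAlgebra 𝓘(ℝ, E) G →L[ℝ] GroupLieAlgebra 𝓘(ℝ, E) G →L[ℝ] GroupLieAlgebra 𝓘(ℝ, E) G :=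
  haveI : CompleteSpace E := FiniteDimensional.complete ℝ E
  haveI : LieGroup 𝓘(ℝ, E) (minSmoothness ℝ 3) G := LieGroup.of_le (n := ∞) (by
    rw [minSmoothness_of_isRCLikeNormedField]; exact ENat.LEInfty.out)
  (LinearMap.mk₂ ℝ (fun u v : GroupLieAlgebra 𝓘(ℝ, E) G => ⁅u, v⁆)
    add_lie smul_lie lie_add (fun c u v => lie_smul c u v)).toContinuousBilinearMap

/-- The adjoint action `Ad_g`, the differential at `1` of `h ↦ g h g⁻¹`. -/
def lieAd (g : G) : GroupLieAlgebra 𝓘(ℝ, E) G →L[ℝ] GroupLieAlgebra 𝓘(ℝ, E) G :=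
  mfderiv 𝓘(ℝ, E) 𝓘(ℝ, E) (fun h : G => g * h * g⁻¹) 1

/-- The right-invariant Maurer-Cartan form (`dg g⁻¹` for a matrix group): at `g`, the differential
of right translation by `g⁻¹`. -/
def maurerCartan (g : G) : TangentSpace 𝓘(ℝ, E) g →L[ℝ] GroupLieAlgebra 𝓘(ℝ, E) G :=
  mfderiv 𝓘(ℝ, E) 𝓘(ℝ, E) (fun h : G => h * g⁻¹) g

end LieGroups

/-! ## Crossed modules of Lie groups (strict Lie 2-groups) and their strict Lie 2-algebras -/

/-- A crossed module of Lie groups `(H₁, H₀, Ψ, Φ)`. -/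
structure LieCrossedModule (E₁ E₀ H₁ H₀ : Type*)
    [NormedAddCommGroup E₁] [NormedSpace ℝ E₁] [NormedAddCommGroup E₀] [NormedSpace ℝ E₀]
    [TopologicalSpace H₁] [ChartedSpace E₁ H₁] [Group H₁]
    [TopologicalSpace H₀] [ChartedSpace E₀ H₀] [Group H₀] where
  /-- The homomorphism `H₁ → H₀`. -/
  Ψ : H₁ →* H₀
  /-- The action of `H₀` on `H₁` by group automorphisms. -/
  Φ : H₀ →* MulAut H₁
  smooth_Ψ : ContMDiff 𝓘(ℝ, E₁) 𝓘(ℝ, E₀) ∞ Ψ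
  smooth_Φ : ContMDiff (𝓘(ℝ, E₀).prod 𝓘(ℝ, E₁)) 𝓘(ℝ, E₁) ∞ fun p : H₀ × H₁ => Φ p.1 p.2
  equivariant : ∀ (g : H₀) (h : H₁), Ψ (Φ g h) = g * Ψ h * g⁻¹
  peiffer : ∀ h h' : H₁, Φ (Ψ h) h' = h * h' * h⁻¹

namespace LieCrossedModule

variable {E₁ E₀ H₁ H₀ : Type*}
  [NormedAddCommGroup E₁] [NormedSpace ℝ E₁] [NormedAddCommGroup E₀] [NormedSpace ℝ E₀]
  [TopologicalSpace H₁] [ChartedSpace E₁ H₁] [Group H₁]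
  [TopologicalSpace H₀] [ChartedSpace E₀ H₀] [Group H₀]

/-- `𝔩₁ : 𝔥₁ → 𝔥₀`, the differential of `Ψ` at `1`. -/
def l1 (Γ : LieCrossedModule E₁ E₀ H₁ H₀) :
    GroupLieAlgebra 𝓘(ℝ, E₁) H₁ →L[ℝ] GroupLieAlgebra 𝓘(ℝ, E₀) H₀ :=
  mfderiv 𝓘(ℝ, E₁) 𝓘(ℝ, E₀) Γ.Ψ 1

/-- `(Φ_g)_* : 𝔥₁ → 𝔥₁`, the differential of `Φ_g` at `1`. -/
def push (Γ : LieCrossedModule E₁ E₀ H₁ H₀) (g : H₀) :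
    GroupLieAlgebra 𝓘(ℝ, E₁) H₁ →L[ℝ] GroupLieAlgebra 𝓘(ℝ, E₁) H₁ :=
  mfderiv 𝓘(ℝ, E₁) 𝓘(ℝ, E₁) (Γ.Φ g) 1

/-- `𝔩₂ : 𝔥₀ × 𝔥₀ → 𝔥₀`, the Lie bracket of the Lie algebra of `H₀`. -/
def l2 [FiniteDimensional ℝ E₀] [LieGroup 𝓘(ℝ, E₀) ∞ H₀] (_Γ : LieCrossedModule E₁ E₀ H₁ H₀) :
    GroupLieAlgebra 𝓘(ℝ, E₀) H₀ →L[ℝ] GroupLieAlgebra 𝓘(ℝ, E₀) H₀ →L[ℝ]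
      GroupLieAlgebra 𝓘(ℝ, E₀) H₀ :=
  lieBracketCLM E₀ H₀

/-- `𝔩₂ : 𝔥₀ × 𝔥₁ → 𝔥₁`, the infinitesimal action: the differential at `1` of the representation
`g ↦ (Φ_g)_*` of `H₀` on `𝔥₁`. -/
def act (Γ : LieCrossedModule E₁ E₀ H₁ H₀) :
    GroupLieAlgebra 𝓘(ℝ, E₀) H₀ →L[ℝ] GroupLieAlgebra 𝓘(ℝ, E₁) H₁ →L[ℝ]
      GroupLieAlgebra 𝓘(ℝ, E₁) H₁ :=
  mfderiv 𝓘(ℝ, E₀)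
    𝓘(ℝ, GroupLieAlgebra 𝓘(ℝ, E₁) H₁ →L[ℝ] GroupLieAlgebra 𝓘(ℝ, E₁) H₁) Γ.push 1

/-- `S` makes the strict Lie 2-algebra `(𝔥₁ ⊕ 𝔥₀; 𝔩₁, 𝔩₂)` quadratic. A graded symmetric bilinear
form of degree 1 on `𝔥₁ ⊕ 𝔥₀` is the same thing as a pairing of `𝔥₀` with `𝔥₁`: it vanishes on
`𝔥₀ × 𝔥₀` and on `𝔥₁ × 𝔥₁`, and `S(m, u) = S(u, m)`. -/
structure IsQuadratic [FiniteDimensional ℝ E₀] [LieGroup 𝓘(ℝ, E₀) ∞ H₀]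
    (Γ : LieCrossedModule E₁ E₀ H₁ H₀)
    (S : GroupLieAlgebra 𝓘(ℝ, E₀) H₀ →L[ℝ] GroupLieAlgebra 𝓘(ℝ, E₁) H₁ →L[ℝ] ℝ) : Prop where
  nondegenerate_left : ∀ u, (∀ m, S u m = 0) → u = 0
  nondegenerate_right : ∀ m, (∀ u, S u m = 0) → m = 0
  l1_symm : ∀ m p, S (Γ.l1 m) p = S (Γ.l1 p) m
  invariant : ∀ u v m, S (Γ.l2 u v) m + S v (Γ.act u m) = 0

variable {E M : Type*} [NormedAddCommGroup E] [NormedSpace ℝ E]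
  [TopologicalSpace M] [ChartedSpace E M]

/-- A `Γ`-connection on `M`: a smooth `𝔥₀`-valued 1-form `A` and a smooth `𝔥₁`-valued
2-form `B`. -/
structure Connection (_Γ : LieCrossedModule E₁ E₀ H₁ H₀) (E M : Type*)
    [NormedAddCommGroup E] [NormedSpace ℝ E] [TopologicalSpace M] [ChartedSpace E M] where
  A : DForm E M (GroupLieAlgebra 𝓘(ℝ, E₀) H₀) 1
  B : DForm E M (GroupLieAlgebra 𝓘(ℝ, E₁) H₁) 2
  smooth_A : A.IsSmooth
  smooth_B : B.IsSmooth

/-- The curvature `dB + 𝔩₂(A, B)`. -/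
def Connection.curv {Γ : LieCrossedModule E₁ E₀ H₁ H₀} (c : Γ.Connection E M) :
    DForm E M (GroupLieAlgebra 𝓘(ℝ, E₁) H₁) 3 :=
  c.B.d + DForm.wedge Γ.act c.A c.B

/-- The fake curvature `dA + ½ 𝔩₂(A, A) - 𝔩₁(B)`. -/
def Connection.fcurv [FiniteDimensional ℝ E₀] [LieGroup 𝓘(ℝ, E₀) ∞ H₀]
    {Γ : LieCrossedModule E₁ E₀ H₁ H₀} (c : Γ.Connection E M) :
    DForm E M (GroupLieAlgebra 𝓘(ℝ, E₀) H₀) 2 :=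
  c.A.d + (1 / 2 : ℝ) • DForm.wedge Γ.l2 c.A c.A - DForm.map (fun _ => Γ.l1) c.B

/-- The pullback `g^*θ̄` of the right-invariant Maurer-Cartan form along `g : M → H₀`. -/
def pullbackMC (E₀ E : Type*) {H₀ M : Type*} [NormedAddCommGroup E₀] [NormedSpace ℝ E₀]
    [TopologicalSpace H₀] [ChartedSpace E₀ H₀] [Group H₀]
    [NormedAddCommGroup E] [NormedSpace ℝ E] [TopologicalSpace M] [ChartedSpace E M]
    (g : M → H₀) : DForm E M (GroupLieAlgebra 𝓘(ℝ, E₀) H₀) 1 := fun x =>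
  ContinuousAlternatingMap.ofSubsingleton ℝ (TangentSpace 𝓘(ℝ, E) x)
    (GroupLieAlgebra 𝓘(ℝ, E₀) H₀) (0 : Fin 1)
    ((maurerCartan (g x)).comp (mfderiv 𝓘(ℝ, E) 𝓘(ℝ, E₀) g x))

/-- `(g, φ)` is a gauge transformation from the connection `c = (A, B)` to `c' = (A', B')`. -/
structure IsGaugeTransformation {Γ : LieCrossedModule E₁ E₀ H₁ H₀} (c c' : Γ.Connection E M)
    (g : M → H₀) (φ : DForm E M (GroupLieAlgebra 𝓘(ℝ, E₁) H₁) 1) : Prop where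
  smooth_g : ContMDiff 𝓘(ℝ, E) 𝓘(ℝ, E₀) ∞ g
  smooth_φ : φ.IsSmooth
  A_eq : c'.A = DForm.map (fun x => lieAd (g x)) c.A - pullbackMC E₀ E g
    - DForm.map (fun _ => Γ.l1) φ
  B_eq : c'.B = DForm.map (fun x => Γ.push (g x)) c.B - φ.d
    + (1 / 2 : ℝ) • DForm.wedge Γ.act (DForm.map (fun _ => Γ.l1) φ) φ
    - DForm.wedge Γ.act (DForm.map (fun x => lieAd (g x)) c.A) φ
    + DForm.wedge Γ.act (pullbackMC E₀ E g) φ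

/-- Two connections are gauge equivalent if some gauge transformation relates them. -/
def GaugeEquivalent {Γ : LieCrossedModule E₁ E₀ H₁ H₀} (c c' : Γ.Connection E M) : Prop :=
  ∃ (g : M → H₀) (φ : DForm E M (GroupLieAlgebra 𝓘(ℝ, E₁) H₁) 1),
    IsGaugeTransformation c c' g φ

end LieCrossedModule

end

/-! Write `F` for the fake curvature and `C` for the curvature. A gauge transformation factors into
a group part, `a' = Ad_g A - g^*θ̄`, `b' = (Φ_g)_* B`, followed by a shift by `φ`. The group part
acts on both curvatures by the representations: `F ↦ Ad_g F` (`curvature_gauge`) and `C ↦ (Φ_g)_* C`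
(`covariantDeriv_gauge`). The shift fixes `F` (`fakeCurvature_shift`) and replaces `C` by `C - 𝔩₂(F,
φ)` (`curvature_shift`).

The pairing `S` does not see either change. The extra term `S(F, 𝔩₂(F, φ))` is zero
(`altWedge_self_altWedge_eq_zero`): infinitesimal invariance makes `S(v, 𝔩₂(u, m))` antisymmetric in
`u, v`, while two-forms commute. The representations drop out because `S` is invariant under all of
`H₀` (`IsQuadratic.pairing_invariant`): infinitesimal invariance makes the pairing locally constant
along the group, and each component contains an element that preserves `S`.

The Lie-theoretic input is the derivative of `Ad` and of `(Φ_g)_*` along `g`, and the Maurer-Cartan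
equation for `g^*θ̄`. Both come from second derivatives at `1` of the group operations written in
the chart at `1` (`IsLocalGroup`). The algebraic input is `IsStrictLieTwoAlgebra`. Everything is
computed at the base point of a chart of `M`, where forms become alternating-map-valued functions on
the model space. -/

open scoped Topology

/-! ### Algebra of the wedge product along a bilinear map. -/

section WedgeAlgebra

variable {T T' V W U V' W' U' : Type*}
  [AddCommGroup T] [Module ℝ T] [TopologicalSpace T]
  [AddCommGroup T'] [Module ℝ T'] [TopologicalSpace T']
  [NormedAddCommGroup V] [NormedSpace ℝ V] [NormedAddCommGroup W] [NormedSpace ℝ W]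
  [NormedAddCommGroup U] [NormedSpace ℝ U]
  [NormedAddCommGroup V'] [NormedSpace ℝ V'] [NormedAddCommGroup W'] [NormedSpace ℝ W']
  [NormedAddCommGroup U'] [NormedSpace ℝ U'] {k l : ℕ}

theorem altWedge_apply (b : V →L[ℝ] W →L[ℝ] U) (α : T [⋀^Fin k]→L[ℝ] V) (β : T [⋀^Fin l]→L[ℝ] W)
    (v : Fin (k + l) → T) :
    altWedge b α β v = ((k.factorial : ℝ) * (l.factorial : ℝ))⁻¹ •
      ∑ σ : Equiv.Perm (Fin (k + l)), Equiv.Perm.sign σ •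
        b (α fun i => v (σ (Fin.castAdd l i))) (β fun j => v (σ (Fin.natAdd k j))) := by
  simp only [altWedge, ContinuousAlternatingMap.smul_apply,
    ContinuousMultilinearMap.alternatization_apply_apply]
  rfl

theorem altWedge_compContinuousLinearMap (b : V →L[ℝ] W →L[ℝ] U) (α : T [⋀^Fin k]→L[ℝ] V)
    (β : T [⋀^Fin l]→L[ℝ] W) (f : T' →L[ℝ] T) :
    altWedge b (α.compContinuousLinearMap f) (β.compContinuousLinearMap f)
      = (altWedge b α β).compContinuousLinearMap f := by
  ext v
  simp only [altWedge_apply, ContinuousAlternatingMap.compContinuousLinearMap_apply]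
  rfl

/-- With `h` the identity and `H` the invariance of `S`, this removes `Ad_g` and `(Φ_g)_*` from the
paired curvatures. -/
theorem altWedge_compContinuousAlternatingMap {b : V →L[ℝ] W →L[ℝ] U} {b' : V' →L[ℝ] W' →L[ℝ] U'}
    {f : V →L[ℝ] V'} {g : W →L[ℝ] W'} {h : U →L[ℝ] U'} (H : ∀ v w, b' (f v) (g w) = h (b v w))
    (α : T [⋀^Fin k]→L[ℝ] V) (β : T [⋀^Fin l]→L[ℝ] W) :
    altWedge b' (f.compContinuousAlternatingMap α) (g.compContinuousAlternatingMap β)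
      = h.compContinuousAlternatingMap (altWedge b α β) := by
  ext v
  simp [altWedge_apply, H, map_sum]

theorem altWedge_sub_left (b : V →L[ℝ] W →L[ℝ] U) (α α' : T [⋀^Fin k]→L[ℝ] V)
    (β : T [⋀^Fin l]→L[ℝ] W) :
    altWedge b (α - α') β = altWedge b α β - altWedge b α' β := by
  ext v
  simp [altWedge_apply, Finset.sum_sub_distrib, smul_sub]

theorem altWedge_sub_right (b : V →L[ℝ] W →L[ℝ] U) (α : T [⋀^Fin k]→L[ℝ] V)
    (β β' : T [⋀^Fin l]→L[ℝ] W) :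
    altWedge b α (β - β') = altWedge b α β - altWedge b α β' := by
  ext v
  simp [altWedge_apply, Finset.sum_sub_distrib, smul_sub]

theorem sum_perm_fin_two {A : Type*} [AddCommMonoid A] (f : Equiv.Perm (Fin 2) → A) :
    ∑ σ, f σ = f 1 + f (Equiv.swap 0 1) := by
  have h : (Finset.univ : Finset (Equiv.Perm (Fin 2))) = {1, Equiv.swap 0 1} := by decide
  rw [h, Finset.sum_pair (by decide)]

theorem sum_perm_fin_three {A : Type*} [AddCommMonoid A] (f : Equiv.Perm (Fin 3) → A) :
    ∑ σ, f σ = f 1 + (f (Equiv.swap 0 1) + (f (Equiv.swap 0 2) + (f (Equiv.swap 1 2)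
      + (f (Equiv.swap 0 1 * Equiv.swap 1 2) + f (Equiv.swap 1 2 * Equiv.swap 0 1))))) := by
  have h : (Finset.univ : Finset (Equiv.Perm (Fin 3))) = {1, Equiv.swap 0 1, Equiv.swap 0 2,
      Equiv.swap 1 2, Equiv.swap 0 1 * Equiv.swap 1 2, Equiv.swap 1 2 * Equiv.swap 0 1} := by decide
  rw [h, Finset.sum_insert (by decide), Finset.sum_insert (by decide),
    Finset.sum_insert (by decide), Finset.sum_insert (by decide), Finset.sum_pair (by decide)]

theorem ContinuousAlternatingMap.map_pair_swap (β : T [⋀^Fin 2]→L[ℝ] W) (x y : T) :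
    β ![y, x] = -β ![x, y] := by
  have h := β.map_swap ![x, y] (i := 0) (j := 1) (by decide)
  rwa [show ![x, y] ∘ ⇑(Equiv.swap (0 : Fin 2) 1) = ![y, x] by ext i; fin_cases i <;> rfl] at h

theorem altWedge_one_one_apply (b : V →L[ℝ] W →L[ℝ] U) (α : T [⋀^Fin 1]→L[ℝ] V)
    (β : T [⋀^Fin 1]→L[ℝ] W) (v : Fin 2 → T) :
    altWedge b α β v = b (α ![v 0]) (β ![v 1]) - b (α ![v 1]) (β ![v 0]) := by
  have e : ∀ σ : Equiv.Perm (Fin 2), b (α fun i => v (σ (Fin.castAdd 1 i)))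
      (β fun j => v (σ (Fin.natAdd 1 j))) = b (α ![v (σ 0)]) (β ![v (σ 1)]) := fun σ => by
    congr 2 <;> congr 1 <;> ext i <;> fin_cases i <;> rfl
  rw [altWedge_apply]
  change _ • ∑ σ : Equiv.Perm (Fin 2), _ = _
  simp_rw [e]
  rw [sum_perm_fin_two]
  simp [sub_eq_add_neg]

theorem altWedge_one_two_apply (b : V →L[ℝ] W →L[ℝ] U) (α : T [⋀^Fin 1]→L[ℝ] V)
    (β : T [⋀^Fin 2]→L[ℝ] W) (v : Fin 3 → T) :
    altWedge b α β v = b (α ![v 0]) (β ![v 1, v 2]) - b (α ![v 1]) (β ![v 0, v 2])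
      + b (α ![v 2]) (β ![v 0, v 1]) := by
  have e : ∀ σ : Equiv.Perm (Fin 3), b (α fun i => v (σ (Fin.castAdd 2 i)))
      (β fun j => v (σ (Fin.natAdd 1 j))) = b (α ![v (σ 0)]) (β ![v (σ 1), v (σ 2)]) := fun σ => by
    congr 2 <;> congr 1 <;> ext i <;> fin_cases i <;> rfl
  rw [altWedge_apply]
  change _ • ∑ σ : Equiv.Perm (Fin 3), _ = _
  simp_rw [e]
  rw [sum_perm_fin_three]
  have h1 := β.map_pair_swap (v 1) (v 2)
  have h2 := β.map_pair_swap (v 0) (v 2)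
  have h3 := β.map_pair_swap (v 0) (v 1)
  have s02 : (Equiv.swap (0 : Fin 3) 2) 1 = 1 := by decide
  have s01 : (Equiv.swap (0 : Fin 3) 1) 2 = 2 := by decide
  have s12 : (Equiv.swap (1 : Fin 3) 2) 0 = 0 := by decide
  simp [h1, h2, h3, s02, s01, s12]
  module

theorem altWedge_two_one_apply (b : V →L[ℝ] W →L[ℝ] U) (α : T [⋀^Fin 2]→L[ℝ] V)
    (β : T [⋀^Fin 1]→L[ℝ] W) (v : Fin 3 → T) :
    altWedge b α β v = b (α ![v 0, v 1]) (β ![v 2]) - b (α ![v 0, v 2]) (β ![v 1])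
      + b (α ![v 1, v 2]) (β ![v 0]) := by
  have e : ∀ σ : Equiv.Perm (Fin 3), b (α fun i => v (σ (Fin.castAdd 1 i)))
      (β fun j => v (σ (Fin.natAdd 2 j))) = b (α ![v (σ 0), v (σ 1)]) (β ![v (σ 2)]) := fun σ => by
    congr 2 <;> congr 1 <;> ext i <;> fin_cases i <;> rfl
  rw [altWedge_apply]
  change _ • ∑ σ : Equiv.Perm (Fin 3), _ = _
  simp_rw [e]
  rw [sum_perm_fin_three]
  have h1 := α.map_pair_swap (v 1) (v 2)
  have h2 := α.map_pair_swap (v 0) (v 2)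
  have h3 := α.map_pair_swap (v 0) (v 1)
  have s02 : (Equiv.swap (0 : Fin 3) 2) 1 = 1 := by decide
  have s01 : (Equiv.swap (0 : Fin 3) 1) 2 = 2 := by decide
  have s12 : (Equiv.swap (1 : Fin 3) 2) 0 = 0 := by decide
  simp [h1, h2, h3, s02, s01, s12]
  module

/-- If an even permutation `τ` turns `f` into `-f`, then the alternating sum of `f` vanishes. -/
theorem sum_sign_smul_eq_zero {ι A : Type*} [Fintype ι] [DecidableEq ι] [AddCommGroup A]
    [Module ℝ A] (f : Equiv.Perm ι → A) (τ : Equiv.Perm ι) (hτ : Equiv.Perm.sign τ = 1)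
    (hf : ∀ σ, f (σ * τ) = -f σ) : ∑ σ, Equiv.Perm.sign σ • f σ = 0 := by
  have h : ∑ σ, Equiv.Perm.sign σ • f σ = -∑ σ, Equiv.Perm.sign σ • f σ := by
    conv_lhs => rw [← Equiv.sum_comp (Equiv.mulRight τ)]
    simp [hτ, hf]
  have h2 : (2 : ℝ) • ∑ σ, Equiv.Perm.sign σ • f σ = 0 := by
    rw [two_smul]
    nth_rewrite 2 [h]
    exact add_neg_cancel _
  exact (smul_eq_zero.mp h2).resolve_left two_ne_zero

/-- An invariance property of the pairing `S` makes `S(F, F·φ)` vanish for every two-form `F`. -/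
theorem altWedge_self_altWedge_eq_zero (S : V →L[ℝ] W →L[ℝ] U) (act : V →L[ℝ] W →L[ℝ] W)
    (H : ∀ u v m, S v (act u m) = -S u (act v m)) (F : T [⋀^Fin 2]→L[ℝ] V)
    (φ : T [⋀^Fin 1]→L[ℝ] W) : altWedge S F (altWedge act F φ) = 0 := by
  ext v
  rw [altWedge_apply]
  change _ • ∑ σ : Equiv.Perm (Fin 5), _ = 0
  have e : ∀ σ : Equiv.Perm (Fin 5), S (F fun i => v (σ (Fin.castAdd 3 i)))
      (altWedge act F φ fun j => v (σ (Fin.natAdd 2 j)))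
      = S (F ![v (σ 0), v (σ 1)]) (act (F ![v (σ 2), v (σ 3)]) (φ ![v (σ 4)]))
        - S (F ![v (σ 0), v (σ 1)]) (act (F ![v (σ 2), v (σ 4)]) (φ ![v (σ 3)]))
        + S (F ![v (σ 0), v (σ 1)]) (act (F ![v (σ 3), v (σ 4)]) (φ ![v (σ 2)])) := fun σ => by
    have h : (fun i : Fin 2 => v (σ (Fin.castAdd 3 i))) = ![v (σ 0), v (σ 1)] := by
      ext i; fin_cases i <;> rfl
    rw [altWedge_two_one_apply, h]
    simp only [map_add, map_sub]
    rfl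
  simp_rw [e, smul_add, smul_sub, Finset.sum_add_distrib, Finset.sum_sub_distrib]
  -- In each of the three sums the permutation exchanges the two arguments of the first `F` with
  -- those of the second. It is a product of two transpositions, hence even, and by `H` the exchange
  -- changes the sign of the summand.
  rw [sum_sign_smul_eq_zero _ (Equiv.swap 0 2 * Equiv.swap 1 3) (by decide),
    sum_sign_smul_eq_zero _ (Equiv.swap 0 2 * Equiv.swap 1 4) (by decide),
    sum_sign_smul_eq_zero _ (Equiv.swap 0 3 * Equiv.swap 1 4) (by decide)]
  · simp
  · intro σ
    rw [H]
    simp only [Equiv.Perm.mul_apply]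
    rfl
  · intro σ
    rw [H]
    simp only [Equiv.Perm.mul_apply]
    rfl
  · intro σ
    rw [H]
    simp only [Equiv.Perm.mul_apply]
    rfl

end WedgeAlgebra

/-! ### Behaviour of the curvatures under gauge transformations, on a normed space. -/

section ExteriorCalculus

variable {X V W : Type*} [NormedAddCommGroup X] [NormedSpace ℝ X]
  [NormedAddCommGroup V] [NormedSpace ℝ V] [NormedAddCommGroup W] [NormedSpace ℝ W]

theorem extDeriv_one_form_apply (α : X → X [⋀^Fin 1]→L[ℝ] V) (y : X) (v : Fin 2 → X) :
    extDeriv α y v = fderiv ℝ α y (v 0) ![v 1] - fderiv ℝ α y (v 1) ![v 0] := by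
  have h0 : Fin.removeNth 0 v = ![v 1] := by ext i; fin_cases i; rfl
  have h1 : Fin.removeNth 1 v = ![v 0] := by ext i; fin_cases i; rfl
  rw [extDeriv, ContinuousAlternatingMap.alternatizeUncurryFin_apply, Fin.sum_univ_two, h0, h1]
  simp [sub_eq_add_neg]

theorem extDeriv_two_form_apply (α : X → X [⋀^Fin 2]→L[ℝ] V) (y : X) (v : Fin 3 → X) :
    extDeriv α y v = fderiv ℝ α y (v 0) ![v 1, v 2] - fderiv ℝ α y (v 1) ![v 0, v 2]
      + fderiv ℝ α y (v 2) ![v 0, v 1] := by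
  have h0 : Fin.removeNth 0 v = ![v 1, v 2] := by ext i; fin_cases i <;> rfl
  have h1 : Fin.removeNth 1 v = ![v 0, v 2] := by ext i; fin_cases i <;> rfl
  have h2 : Fin.removeNth 2 v = ![v 0, v 1] := by ext i; fin_cases i <;> rfl
  rw [extDeriv, ContinuousAlternatingMap.alternatizeUncurryFin_apply, Fin.sum_univ_three,
    h0, h1, h2]
  simp [sub_eq_add_neg]

theorem HasFDerivAt.alternating_apply_const {k : ℕ} {α : X → X [⋀^Fin k]→L[ℝ] V}
    {α' : X →L[ℝ] X [⋀^Fin k]→L[ℝ] V} {y : X} (h : HasFDerivAt α α' y) (m : Fin k → X) :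
    HasFDerivAt (fun z => α z m) ((ContinuousAlternatingMap.apply ℝ X V m).comp α') y :=
  (ContinuousAlternatingMap.apply ℝ X V m).hasFDerivAt.comp y h

/-- Product rule. The derivative is left anonymous since only its values on vectors enter the
curvature computations. -/
theorem HasFDerivAt.clm_compContinuousAlternatingMap {k : ℕ} {P : X → V →L[ℝ] W}
    {P' : X →L[ℝ] V →L[ℝ] W} {α : X → X [⋀^Fin k]→L[ℝ] V} {α' : X →L[ℝ] X [⋀^Fin k]→L[ℝ] V} {y : X}
    (hP : HasFDerivAt P P' y) (hα : HasFDerivAt α α' y) :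
    ∃ L : X →L[ℝ] X [⋀^Fin k]→L[ℝ] W,
      HasFDerivAt (fun z => (P z).compContinuousAlternatingMap (α z)) L y ∧
      ∀ u m, L u m = P' u (α y m) + P y (α' u m) := by
  refine ⟨_, (ContinuousLinearMap.compContinuousAlternatingMapCLM (𝕜 := ℝ) (E := X) (F := V)
    (G := W) (ι := Fin k)).hasFDerivAt_of_bilinear hP hα, fun u m => ?_⟩
  simp [add_comm]

theorem DifferentiableAt.clm_const_compContinuousAlternatingMap {k : ℕ} (f : V →L[ℝ] W)
    {α : X → X [⋀^Fin k]→L[ℝ] V} {y : X} (hα : DifferentiableAt ℝ α y) :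
    DifferentiableAt ℝ (fun z => f.compContinuousAlternatingMap (α z)) y :=
  ((hasFDerivAt_const f y).clm_compContinuousAlternatingMap
    hα.hasFDerivAt).choose_spec.1.differentiableAt

theorem fderiv_clm_const_compContinuousAlternatingMap {k : ℕ} (f : V →L[ℝ] W)
    {α : X → X [⋀^Fin k]→L[ℝ] V} {y : X} (hα : DifferentiableAt ℝ α y) (u : X) (m : Fin k → X) :
    fderiv ℝ (fun z => f.compContinuousAlternatingMap (α z)) y u m = f (fderiv ℝ α y u m) := by
  obtain ⟨L, hL, h⟩ := (hasFDerivAt_const f y).clm_compContinuousAlternatingMap hα.hasFDerivAt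
  rw [hL.fderiv, h]
  simp

/-- The algebraic identities of a strict Lie 2-algebra `l1 : W → V` with bracket `br` on `V` and
action `act` of `V` on `W`. -/
structure IsStrictLieTwoAlgebra (br : V →L[ℝ] V →L[ℝ] V) (act : V →L[ℝ] W →L[ℝ] W)
    (l1 : W →L[ℝ] V) : Prop where
  br_swap : ∀ u v, br u v = -br v u
  act_br : ∀ u v m, act (br u v) m = act u (act v m) - act v (act u m)
  l1_act : ∀ u m, l1 (act u m) = br u (l1 m)
  act_l1_swap : ∀ m p, act (l1 m) p = -act (l1 p) m

section GroupPart

variable {br : V →L[ℝ] V →L[ℝ] V} {act : V →L[ℝ] W →L[ℝ] W} {θ : X → X [⋀^Fin 1]→L[ℝ] V}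
  {a : X → X [⋀^Fin 1]→L[ℝ] V} {b : X → X [⋀^Fin 2]→L[ℝ] W} {y : X}
  {Q : X → V →L[ℝ] V} {Q' : X →L[ℝ] V →L[ℝ] V} {P : X → W →L[ℝ] W} {P' : X →L[ℝ] W →L[ℝ] W}

/-- The curvature `da + ½ [a, a]` is equivariant under gauge transformations. -/
theorem curvature_gauge (hbr : ∀ u v, br u v = -br v u) (hQ : HasFDerivAt Q Q' y)
    (hQ' : ∀ v u, Q' v u = br (θ y ![v]) (Q y u)) (hQbr : ∀ u v, Q y (br u v) = br (Q y u) (Q y v))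
    (hθ : DifferentiableAt ℝ θ y)
    (hdθ : ∀ v w, extDeriv θ y ![v, w] = br (θ y ![v]) (θ y ![w]))
    (ha : DifferentiableAt ℝ a y) {a' : X → X [⋀^Fin 1]→L[ℝ] V}
    (ha' : ∀ z, a' z = (Q z).compContinuousAlternatingMap (a z) - θ z) :
    extDeriv a' y + (1 / 2 : ℝ) • altWedge br (a' y) (a' y)
      = (Q y).compContinuousAlternatingMap
          (extDeriv a y + (1 / 2 : ℝ) • altWedge br (a y) (a y)) := by
  obtain ⟨L, hL, hLa⟩ := hQ.clm_compContinuousAlternatingMap ha.hasFDerivAt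
  have hd : fderiv ℝ a' y = L - fderiv ℝ θ y := by
    rw [show a' = fun z => (Q z).compContinuousAlternatingMap (a z) - θ z from funext ha']
    exact (hL.sub hθ.hasFDerivAt).fderiv
  ext v
  have h := hdθ (v 0) (v 1)
  rw [extDeriv_one_form_apply] at h
  simp only [Matrix.cons_val_zero, Matrix.cons_val_one] at h
  simp only [ContinuousAlternatingMap.add_apply, ContinuousAlternatingMap.smul_apply,
    extDeriv_one_form_apply, altWedge_one_one_apply, hd, ha',
    ContinuousLinearMap.compContinuousAlternatingMap_coe, Function.comp_apply,
    ContinuousAlternatingMap.sub_apply, _root_.sub_apply, hLa, hQ', map_add, map_sub,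
    map_smul, hQbr]
  -- Differentiating `Q` produces the mixed terms in `θ` and `Q a`; antisymmetry of the bracket
  -- cancels them against those of `½ [a', a']`. The terms quadratic in `θ` cancel by the
  -- Maurer-Cartan equation `h`.
  have e1 := hbr (Q y (a y ![v 0])) (θ y ![v 1])
  have e2 := hbr (Q y (a y ![v 1])) (θ y ![v 0])
  have e3 := hbr (θ y ![v 1]) (θ y ![v 0])
  rw [e1, e2, e3]
  linear_combination (norm := module) -h

/-- The covariant derivative of a two-form is equivariant under gauge transformations. -/
theorem covariantDeriv_gauge (hP : HasFDerivAt P P' y)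
    (hP' : ∀ v m, P' v m = act (θ y ![v]) (P y m))
    (hPact : ∀ u m, P y (act u m) = act (Q y u) (P y m))
    (hb : DifferentiableAt ℝ b y) {a' : X → X [⋀^Fin 1]→L[ℝ] V}
    (ha' : ∀ z, a' z = (Q z).compContinuousAlternatingMap (a z) - θ z) :
    extDeriv (fun z => (P z).compContinuousAlternatingMap (b z)) y
        + altWedge act (a' y) ((P y).compContinuousAlternatingMap (b y))
      = (P y).compContinuousAlternatingMap (extDeriv b y + altWedge act (a y) (b y)) := by
  obtain ⟨L, hL, hLb⟩ := hP.clm_compContinuousAlternatingMap hb.hasFDerivAt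
  ext v
  simp only [ContinuousAlternatingMap.add_apply, extDeriv_two_form_apply, altWedge_one_two_apply,
    hL.fderiv, ha', ContinuousLinearMap.compContinuousAlternatingMap_coe, Function.comp_apply,
    ContinuousAlternatingMap.sub_apply, _root_.sub_apply, hLb, hP', map_add, map_sub,
    hPact]
  abel

end GroupPart

section FormPart

variable {br : V →L[ℝ] V →L[ℝ] V} {act : V →L[ℝ] W →L[ℝ] W} {l1 : W →L[ℝ] V}
  {a A' : X → X [⋀^Fin 1]→L[ℝ] V} {b B' : X → X [⋀^Fin 2]→L[ℝ] W} {φ : X → X [⋀^Fin 1]→L[ℝ] W}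
  {y : X}

/-- By `l1_act`, applying `l1` to the correction terms of `B'` gives exactly the terms that `-l1 φ`
adds to `da + ½ [a, a]`. As `B'` is not differentiated, its formula is needed only at `y`, whereas
that of `A'` is needed near `y`. -/
theorem fakeCurvature_shift (H : IsStrictLieTwoAlgebra br act l1)
    (ha : DifferentiableAt ℝ a y) (hφ : DifferentiableAt ℝ φ y)
    (hA' : A' =ᶠ[𝓝 y] fun z => a z - l1.compContinuousAlternatingMap (φ z))
    (hB' : B' y = b y - extDeriv φ y
      + (1 / 2 : ℝ) • altWedge act (l1.compContinuousAlternatingMap (φ y)) (φ y)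
      - altWedge act (a y) (φ y)) :
    extDeriv A' y + (1 / 2 : ℝ) • altWedge br (A' y) (A' y) - l1.compContinuousAlternatingMap (B' y)
      = extDeriv a y + (1 / 2 : ℝ) • altWedge br (a y) (a y)
        - l1.compContinuousAlternatingMap (b y) := by
  have hlφ := hφ.clm_const_compContinuousAlternatingMap l1
  have hd : fderiv ℝ A' y
      = fderiv ℝ a y - fderiv ℝ (fun z => l1.compContinuousAlternatingMap (φ z)) y := by
    rw [hA'.fderiv_eq]
    exact (ha.hasFDerivAt.sub hlφ.hasFDerivAt).fderiv
  ext v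
  simp only [ContinuousAlternatingMap.add_apply, ContinuousAlternatingMap.smul_apply,
    extDeriv_one_form_apply, altWedge_one_one_apply, hd, hA'.eq_of_nhds, hB',
    ContinuousLinearMap.compContinuousAlternatingMap_coe, Function.comp_apply,
    ContinuousAlternatingMap.sub_apply, _root_.sub_apply, map_add, map_sub,
    map_smul, fderiv_clm_const_compContinuousAlternatingMap l1 hφ, H.l1_act]
  have e1 := H.br_swap (l1 (φ y ![v 0])) (a y ![v 1])
  have e2 := H.br_swap (l1 (φ y ![v 1])) (a y ![v 0])
  rw [e1, e2]
  module

set_option maxHeartbeats 1000000 in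
-- Here the roles are reversed: `B'` is differentiated and `A'` is not. The terms linear in `φ`
-- assemble into the action of the fake curvature on `φ`, using `d(dφ) = 0`; those of higher order
-- in `φ` cancel by the identities in `H`.
theorem curvature_shift (H : IsStrictLieTwoAlgebra br act l1)
    (ha : DifferentiableAt ℝ a y) (hb : DifferentiableAt ℝ b y) (hBd : DifferentiableAt ℝ B' y)
    (hφ : ContDiffAt ℝ ∞ φ y)
    (hA' : A' y = a y - l1.compContinuousAlternatingMap (φ y))
    (hB' : B' =ᶠ[𝓝 y] fun z => b z - extDeriv φ z
      + (1 / 2 : ℝ) • altWedge act (l1.compContinuousAlternatingMap (φ z)) (φ z)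
      - altWedge act (a z) (φ z)) :
    extDeriv B' y + altWedge act (A' y) (B' y)
      = extDeriv b y + altWedge act (a y) (b y)
        - altWedge act (extDeriv a y + (1 / 2 : ℝ) • altWedge br (a y) (a y)
            - l1.compContinuousAlternatingMap (b y)) (φ y) := by
  have hφ1 : DifferentiableAt ℝ φ y := hφ.differentiableAt (by simp)
  have hdφ : DifferentiableAt ℝ (extDeriv φ) y := by
    have h : DifferentiableAt ℝ (fderiv ℝ φ) y :=
      (hφ.fderiv_right (m := 1) (show (2 : ℕ∞ω) ≤ ∞ from ENat.LEInfty.out)).differentiableAt (by simp)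
    exact (ContinuousAlternatingMap.alternatizeUncurryFinCLM ℝ X W).differentiableAt.comp y h
  have hddφ : extDeriv (extDeriv φ) y = 0 :=
    extDeriv_extDeriv_apply hφ (by
      rw [minSmoothness_of_isRCLikeNormedField]; exact ENat.LEInfty.out)
  -- `w` collects the algebraic correction terms. Its differentiability is inherited from `B'`, `b`
  -- and `dφ`, so its derivative can be found by evaluating on constant vectors, with no
  -- differentiation of wedge products.
  set w : X → X [⋀^Fin 2]→L[ℝ] W := fun z => B' z - b z + extDeriv φ z with hw
  have hwd : DifferentiableAt ℝ w y := (hBd.sub hb).add hdφ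
  have hdB : fderiv ℝ B' y = fderiv ℝ b y - fderiv ℝ (extDeriv φ) y + fderiv ℝ w y := by
    have : fderiv ℝ w y = fderiv ℝ B' y - fderiv ℝ b y + fderiv ℝ (extDeriv φ) y :=
      ((hBd.hasFDerivAt.sub hb.hasFDerivAt).add hdφ.hasFDerivAt).fderiv
    rw [this]; abel
  have hweq : ∀ p q, (fun z => w z ![p, q]) =ᶠ[𝓝 y] fun z => act (l1 (φ z ![p])) (φ z ![q])
      - (act (a z ![p]) (φ z ![q]) - act (a z ![q]) (φ z ![p])) := fun p q => by
    filter_upwards [hB'] with z hz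
    -- By this antisymmetry the two terms of the wedge of `l1 φ` with `φ` agree, which absorbs the
    -- factor `½`.
    have e := H.act_l1_swap (φ z ![q]) (φ z ![p])
    simp only [hw, hz, ContinuousAlternatingMap.add_apply, ContinuousAlternatingMap.smul_apply,
      ContinuousAlternatingMap.sub_apply, altWedge_one_one_apply, Matrix.cons_val_zero,
      Matrix.cons_val_one, ContinuousLinearMap.compContinuousAlternatingMap_coe,
      Function.comp_apply, e]
    module
  have hdw : ∀ u p q, fderiv ℝ w y u ![p, q]
      = act (l1 (φ y ![p])) (fderiv ℝ φ y u ![q]) + act (l1 (fderiv ℝ φ y u ![p])) (φ y ![q])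
        - (act (a y ![p]) (fderiv ℝ φ y u ![q]) + act (fderiv ℝ a y u ![p]) (φ y ![q])
          - (act (a y ![q]) (fderiv ℝ φ y u ![p]) + act (fderiv ℝ a y u ![q]) (φ y ![p]))) := by
    intro u p q
    have fφ := fun m => hφ1.hasFDerivAt.alternating_apply_const m
    have fa := fun m => ha.hasFDerivAt.alternating_apply_const m
    have hD := (act.hasFDerivAt_of_bilinear (l1.hasFDerivAt.comp y (fφ ![p])) (fφ ![q])).sub
      ((act.hasFDerivAt_of_bilinear (fa ![p]) (fφ ![q])).sub
        (act.hasFDerivAt_of_bilinear (fa ![q]) (fφ ![p])))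
    have h1 := (hwd.hasFDerivAt.alternating_apply_const ![p, q]).unique
      (hD.congr_of_eventuallyEq (hweq p q))
    have h2 := congrArg (fun L : X →L[ℝ] W => L u) h1
    simpa using h2
  have hBy : ∀ p q, B' y ![p, q] = b y ![p, q] - extDeriv φ y ![p, q]
      + (act (l1 (φ y ![p])) (φ y ![q])
      - (act (a y ![p]) (φ y ![q]) - act (a y ![q]) (φ y ![p]))) := fun p q => by
    rw [← (hweq p q).eq_of_nhds]
    simp only [hw, ContinuousAlternatingMap.add_apply, ContinuousAlternatingMap.sub_apply]
    abel
  -- The derivation property of `u` on the bracket `(m, p) ↦ act (l1 m) p`. It serves as a rewriting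
  -- rule that brings iterated actions to a normal form, after which the goal is linear.
  have hK : ∀ u m p, act u (act (l1 m) p) = act (l1 m) (act u p) - act (l1 p) (act u m) := by
    intro u m p
    have h1 := H.act_br u (l1 m) p
    rw [← H.l1_act, H.act_l1_swap] at h1
    linear_combination (norm := module) -h1
  ext v
  have hdd : extDeriv (extDeriv φ) y v = 0 := by rw [hddφ]; rfl
  rw [extDeriv_two_form_apply] at hdd
  have sd := fun i j k => H.act_l1_swap (fderiv ℝ φ y (v i) ![v j]) (φ y ![v k])
  have sb := fun i j k => H.act_l1_swap (b y ![v i, v j]) (φ y ![v k])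
  have k01 := fun i => hK (a y ![v i]) (φ y ![v 0]) (φ y ![v 1])
  have k02 := fun i => hK (a y ![v i]) (φ y ![v 0]) (φ y ![v 2])
  have k12 := fun i => hK (a y ![v i]) (φ y ![v 1]) (φ y ![v 2])
  have kf := hK (l1 (φ y ![v 0])) (φ y ![v 1]) (φ y ![v 2])
  simp only [ContinuousAlternatingMap.add_apply, ContinuousAlternatingMap.smul_apply,
    ContinuousAlternatingMap.sub_apply, extDeriv_one_form_apply, extDeriv_two_form_apply,
    altWedge_one_two_apply, altWedge_two_one_apply, altWedge_one_one_apply, hdB, hA', hBy, hdw,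
    ContinuousLinearMap.compContinuousAlternatingMap_coe, Function.comp_apply, _root_.add_apply,
    _root_.sub_apply, _root_.smul_apply, map_add, map_sub, map_smul, H.act_br,
    Matrix.cons_val_zero, Matrix.cons_val_one, sd, sb, k01, k02, k12, kf]
  linear_combination (norm := module) -hdd

end FormPart

end ExteriorCalculus

/-! ### Second-order calculus of a local group in a chart. -/

section LocalGroup

variable {E F : Type*} [NormedAddCommGroup E] [NormedSpace ℝ E]
  [NormedAddCommGroup F] [NormedSpace ℝ F]

/-- A map of two variables that is `C²` at a point has differentiable partial derivatives there. -/
theorem ContDiffAt.hasFDerivAt_fderiv_comp {X Y : Type*} [NormedAddCommGroup X] [NormedSpace ℝ X]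
    [NormedAddCommGroup Y] [NormedSpace ℝ Y] {f : E → F} {c : X → E} {c' : X →L[ℝ] E} {x : X}
    (hf : ContDiffAt ℝ 2 f (c x)) (hc : HasFDerivAt c c' x) (j : Y →L[ℝ] E) :
    ∃ L : X →L[ℝ] Y →L[ℝ] F, HasFDerivAt (fun z => (fderiv ℝ f (c z)).comp j) L x ∧
      ∀ u v, L u v = fderiv ℝ (fderiv ℝ f) (c x) (c' u) (j v) := by
  have h : DifferentiableAt ℝ (fderiv ℝ f) (c x) :=
    (hf.fderiv_right (m := 1) (by norm_num)).differentiableAt (by simp)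
  refine ⟨_, (h.hasFDerivAt.comp x hc).clm_comp (hasFDerivAt_const j x), fun u v => ?_⟩
  simp

/-- The second-order data of a local group `μ` with unit `o`, written in a chart: `A (x, y)` is the
conjugate of `y` by `x` and `δ (x, y)` is `x` divided by `y`. -/
structure IsLocalGroup (o : E) (μ A δ : E × E → E) : Prop where
  contDiffAt_mul : ContDiffAt ℝ 2 μ (o, o)
  contDiffAt_conj : ContDiffAt ℝ 2 A (o, o)
  contDiffAt_div : ContDiffAt ℝ 2 δ (o, o)
  mul_one : ∀ᶠ x in 𝓝 o, μ (x, o) = x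
  one_mul : ∀ᶠ x in 𝓝 o, μ (o, x) = x
  conj_one : ∀ᶠ x in 𝓝 o, A (x, o) = o
  div_self : ∀ᶠ x in 𝓝 o, δ (x, x) = o
  conj_mul : ∀ᶠ p in 𝓝 (o, o), μ (A p, p.1) = μ p
  div_mul : ∀ᶠ p in 𝓝 (o, o), μ (δ p, p.2) = p.1

/-- The bracket of a local group, from the mixed second derivative of its multiplication. -/
noncomputable def localBracket (o : E) (μ : E × E → E) (v w : E) : E :=
  fderiv ℝ (fderiv ℝ μ) (o, o) (v, 0) (0, w) - fderiv ℝ (fderiv ℝ μ) (o, o) (w, 0) (0, v)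

namespace IsLocalGroup

variable {o : E} {μ A δ : E × E → E}

theorem fderiv_mul_inl (h : IsLocalGroup o μ A δ) (v : E) : fderiv ℝ μ (o, o) (v, 0) = v := by
  have hd := (h.contDiffAt_mul.differentiableAt (by simp)).hasFDerivAt
  have h1 := HasFDerivAt.comp (f := fun x : E => (x, o)) o hd
    ((hasFDerivAt_id o).prodMk (hasFDerivAt_const o o))
  have h2 := (h1.congr_of_eventuallyEq (f₁ := id)
    (h.mul_one.mono fun x hx => hx.symm)).unique (hasFDerivAt_id o)
  simpa using congrArg (fun L : E →L[ℝ] E => L v) h2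

theorem fderiv_mul_inr (h : IsLocalGroup o μ A δ) (v : E) : fderiv ℝ μ (o, o) (0, v) = v := by
  have hd := (h.contDiffAt_mul.differentiableAt (by simp)).hasFDerivAt
  have h1 := HasFDerivAt.comp (f := fun x : E => (o, x)) o hd
    ((hasFDerivAt_const o o).prodMk (hasFDerivAt_id o))
  have h2 := (h1.congr_of_eventuallyEq (f₁ := id)
    (h.one_mul.mono fun x hx => hx.symm)).unique (hasFDerivAt_id o)
  simpa using congrArg (fun L : E →L[ℝ] E => L v) h2

theorem second_fderiv_symm (h : IsLocalGroup o μ A δ) (p q : E × E) :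
    fderiv ℝ (fderiv ℝ μ) (o, o) p q = fderiv ℝ (fderiv ℝ μ) (o, o) q p :=
  (h.contDiffAt_mul.isSymmSndFDerivAt (by simp)) p q

/-- If `μ (f x, j x) = k x` identically, then the derivative in one direction of the first partial
derivative of `μ` composed with a family of linear maps is determined. -/
theorem hasFDerivAt_of_comp_eq (h : IsLocalGroup o μ A δ) {R S : E → E →L[ℝ] E}
    {R₀ S₀ : E →L[ℝ] E →L[ℝ] E} (hR : HasFDerivAt R R₀ o) (hS : HasFDerivAt S S₀ o)
    (hRo : R o = ContinuousLinearMap.id ℝ E)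
    (hRS : ∀ᶠ x in 𝓝 o, ∀ v, fderiv ℝ μ (o, x) (R x v, 0) = S x v) (w v : E) :
    R₀ w v = S₀ w v - fderiv ℝ (fderiv ℝ μ) (o, o) (v, 0) (0, w) := by
  obtain ⟨L, hL, hL'⟩ := h.contDiffAt_mul.hasFDerivAt_fderiv_comp (c := fun x => (o, x)) (x := o)
    ((hasFDerivAt_const o o).prodMk (hasFDerivAt_id o)) (ContinuousLinearMap.inl ℝ E E)
  have h1 := (hL.clm_comp hR).congr_of_eventuallyEq (f₁ := S)
    (hRS.mono fun x hx => by ext v; simpa using (hx v).symm)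
  have h2 := congrArg (fun L : E →L[ℝ] E →L[ℝ] E => L w v) (hS.unique h1)
  simp only [_root_.add_apply, ContinuousLinearMap.comp_apply,
    ContinuousLinearMap.compL_apply, ContinuousLinearMap.flip_apply, hL', hRo] at h2
  simp [h.fderiv_mul_inl] at h2
  rw [h2, h.second_fderiv_symm (v, 0)]
  abel

/-- The derivative of `Ad` at the unit is the bracket. Differentiating `μ (A (x, y), x) = μ (x, y)`
in `y` at `y = o` gives `∂₁μ(o, x) ∘ ∂₂A(x, o) = ∂₂μ(x, o)`; differentiating this in `x` at `o`
gives the difference of two mixed second derivatives of `μ`. -/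
theorem conj_hasFDerivAt (h : IsLocalGroup o μ A δ) :
    ∃ L : E →L[ℝ] E →L[ℝ] E,
      HasFDerivAt (fun x => (fderiv ℝ A (x, o)).comp (ContinuousLinearMap.inr ℝ E E)) L o ∧
      ∀ w v, L w v = localBracket o μ w v := by
  have hc : HasFDerivAt (fun x : E => (x, o)) ((ContinuousLinearMap.id ℝ E).prod 0) o :=
    (hasFDerivAt_id o).prodMk (hasFDerivAt_const o o)
  obtain ⟨L, hL, -⟩ := h.contDiffAt_conj.hasFDerivAt_fderiv_comp (c := fun x => (x, o)) (x := o) hc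
    (ContinuousLinearMap.inr ℝ E E)
  obtain ⟨K, hK, hK'⟩ := h.contDiffAt_mul.hasFDerivAt_fderiv_comp (c := fun x => (x, o)) (x := o) hc
    (ContinuousLinearMap.inr ℝ E E)
  have hRS : ∀ᶠ x in 𝓝 o, ∀ v, fderiv ℝ μ (o, x) (fderiv ℝ A (x, o) (0, v), 0)
      = fderiv ℝ μ (x, o) (0, v) := by
    have t1 : Filter.Tendsto (fun x : E => (x, o)) (𝓝 o) (𝓝 (o, o)) := hc.continuousAt
    have t2 : Filter.Tendsto (fun x : E => (o, x)) (𝓝 o) (𝓝 (o, o)) :=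
      ((continuous_const.prodMk continuous_id).tendsto' o _ rfl)
    filter_upwards [t1.eventually (h.conj_mul.eventually_nhds), h.conj_one,
      t1.eventually (h.contDiffAt_conj.eventually (by simp)),
      t2.eventually (h.contDiffAt_mul.eventually (by simp))] with x h1 h2 h3 h4 v
    have d1 := (h3.differentiableAt (by simp)).hasFDerivAt
    have d2 : HasFDerivAt μ (fderiv ℝ μ (o, x)) ((fun p => (A p, p.1)) (x, o)) := by
      simpa [h2] using (h4.differentiableAt (by simp)).hasFDerivAt
    have d3 := d2.comp (x, o) (d1.prodMk (hasFDerivAt_fst (𝕜 := ℝ)))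
    have d4 := (d3.congr_of_eventuallyEq (f₁ := μ) (h1.mono fun p hp => hp.symm)).fderiv
    rw [d4]
    simp
  have hAo : (fderiv ℝ A (o, o)).comp (ContinuousLinearMap.inr ℝ E E)
      = ContinuousLinearMap.id ℝ E := by
    ext v
    have := hRS.self_of_nhds v
    rw [h.fderiv_mul_inl, h.fderiv_mul_inr] at this
    simpa using this
  refine ⟨L, hL, fun w v => ?_⟩
  rw [h.hasFDerivAt_of_comp_eq hL hK hAo (hRS.mono fun x hx v => by simpa using hx v), hK']
  simp [localBracket]

/-- `x ↦ ∂₁δ(x, x)` is the right-invariant Maurer-Cartan form in the chart, so its antisymmetrized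
derivative is the structure equation at the unit. Differentiating `μ (δ (x, y), y) = x` in `x` on
the diagonal shows that it is inverse to `∂₁μ(o, x)`. -/
theorem div_hasFDerivAt (h : IsLocalGroup o μ A δ) :
    (fderiv ℝ δ (o, o)).comp (ContinuousLinearMap.inl ℝ E E) = ContinuousLinearMap.id ℝ E ∧
    ∃ L : E →L[ℝ] E →L[ℝ] E,
      HasFDerivAt (fun x => (fderiv ℝ δ (x, x)).comp (ContinuousLinearMap.inl ℝ E E)) L o ∧
      ∀ w v, L w v - L v w = localBracket o μ w v := by
  have hc : HasFDerivAt (fun x : E => (x, x))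
      ((ContinuousLinearMap.id ℝ E).prod (ContinuousLinearMap.id ℝ E)) o :=
    (hasFDerivAt_id o).prodMk (hasFDerivAt_id o)
  obtain ⟨L, hL, -⟩ := h.contDiffAt_div.hasFDerivAt_fderiv_comp (c := fun x => (x, x)) (x := o) hc
    (ContinuousLinearMap.inl ℝ E E)
  have hRS : ∀ᶠ x in 𝓝 o, ∀ v, fderiv ℝ μ (o, x) (fderiv ℝ δ (x, x) (v, 0), 0) = v := by
    have t1 : Filter.Tendsto (fun x : E => (x, x)) (𝓝 o) (𝓝 (o, o)) := hc.continuousAt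
    have t2 : Filter.Tendsto (fun x : E => (o, x)) (𝓝 o) (𝓝 (o, o)) :=
      ((continuous_const.prodMk continuous_id).tendsto' o _ rfl)
    filter_upwards [t1.eventually (h.div_mul.eventually_nhds), h.div_self,
      t1.eventually (h.contDiffAt_div.eventually (by simp)),
      t2.eventually (h.contDiffAt_mul.eventually (by simp))] with x h1 h2 h3 h4 v
    have d1 := (h3.differentiableAt (by simp)).hasFDerivAt
    have d2 : HasFDerivAt μ (fderiv ℝ μ (o, x)) ((fun p => (δ p, p.2)) (x, x)) := by
      simpa [h2] using (h4.differentiableAt (by simp)).hasFDerivAt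
    have d3 := d2.comp (x, x) (d1.prodMk (hasFDerivAt_snd (𝕜 := ℝ)))
    have d4 := (d3.congr_of_eventuallyEq (f₁ := Prod.fst) (h1.mono fun p hp => hp.symm)).unique
      (hasFDerivAt_fst (𝕜 := ℝ))
    simpa using congrArg (fun L : E × E →L[ℝ] E => L (v, 0)) d4
  have hδo : (fderiv ℝ δ (o, o)).comp (ContinuousLinearMap.inl ℝ E E)
      = ContinuousLinearMap.id ℝ E := by
    ext v
    have := hRS.self_of_nhds v
    rw [h.fderiv_mul_inl] at this
    simpa using this
  refine ⟨hδo, L, hL, fun w v => ?_⟩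
  have hS : HasFDerivAt (𝕜 := ℝ) (fun _ : E => ContinuousLinearMap.id ℝ E) 0 o := hasFDerivAt_const _ _
  have hR : ∀ᶠ x in 𝓝 o, ∀ v, fderiv ℝ μ (o, x)
      ((fderiv ℝ δ (x, x)).comp (ContinuousLinearMap.inl ℝ E E) v, 0)
        = ContinuousLinearMap.id ℝ E v := hRS.mono fun x hx v => by simpa using hx v
  rw [h.hasFDerivAt_of_comp_eq hL hS hδo hR, h.hasFDerivAt_of_comp_eq hL hS hδo hR]
  simp only [localBracket, _root_.zero_apply]
  abel

end IsLocalGroup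

end LocalGroup

/-! ### A Lie group in its chart at `1`: adjoint action, Maurer-Cartan form and bracket. -/

section LieGroupCharts

variable {E G X : Type*} [NormedAddCommGroup E] [NormedSpace ℝ E]
  [TopologicalSpace G] [ChartedSpace E G]
  [NormedAddCommGroup X] [NormedSpace ℝ X]

/-- The base point `p` is kept apart from `f x` so that the chart at `1` can be used when `f x` is a
product equal to `1` only propositionally. -/
theorem mfderiv_eq_fderiv_extChartAt {f : X → G} {x : X} {p : G} (hp : f x = p)
    (hf : MDifferentiableAt 𝓘(ℝ, X) 𝓘(ℝ, E) f x) :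
    (mfderiv 𝓘(ℝ, X) 𝓘(ℝ, E) f x : X →L[ℝ] E) = fderiv ℝ (extChartAt 𝓘(ℝ, E) p ∘ f) x := by
  subst hp
  refine (if_pos hf).trans ?_
  simp only [writtenInExtChartAt, modelWithCornersSelf_coe, Set.range_id, fderivWithin_univ,
    extChartAt_model_space_eq_id, PartialEquiv.refl_symm, PartialEquiv.refl_coe,
    Function.comp_id, id_eq]
  rfl

theorem mfderiv_eq_fderiv_extChartAt_symm {E' G' : Type*} [NormedAddCommGroup E']
    [NormedSpace ℝ E'] [TopologicalSpace G'] [ChartedSpace E' G'] {f : G → G'} {q : G} {p : G'}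
    (hp : f q = p) (hf : MDifferentiableAt 𝓘(ℝ, E) 𝓘(ℝ, E') f q) :
    (mfderiv 𝓘(ℝ, E) 𝓘(ℝ, E') f q : E →L[ℝ] E')
      = fderiv ℝ (extChartAt 𝓘(ℝ, E') p ∘ f ∘ (extChartAt 𝓘(ℝ, E) q).symm)
          (extChartAt 𝓘(ℝ, E) q q) := by
  subst hp
  refine (if_pos hf).trans ?_
  simp only [writtenInExtChartAt, modelWithCornersSelf_coe, Set.range_id, fderivWithin_univ]
  rfl

theorem contMDiffAt_extChartAt_symm [IsManifold 𝓘(ℝ, E) ∞ G] (p : G) {y : E}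
    (hy : y ∈ (extChartAt 𝓘(ℝ, E) p).target) :
    ContMDiffAt 𝓘(ℝ, E) 𝓘(ℝ, E) ∞ (extChartAt 𝓘(ℝ, E) p).symm y :=
  (contMDiffOn_extChartAt_symm p).contMDiffAt ((isOpen_extChartAt_target p).mem_nhds hy)

theorem mfderiv_comp_of_eq_model {E' G' E'' G'' : Type*}
    [NormedAddCommGroup E'] [NormedSpace ℝ E'] [TopologicalSpace G'] [ChartedSpace E' G']
    [NormedAddCommGroup E''] [NormedSpace ℝ E''] [TopologicalSpace G''] [ChartedSpace E'' G'']
    {f : G' → G''} {k : G → G'} {q : G} {p : G'} (hp : k q = p)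
    (hf : MDifferentiableAt 𝓘(ℝ, E') 𝓘(ℝ, E'') f p)
    (hk : MDifferentiableAt 𝓘(ℝ, E) 𝓘(ℝ, E') k q) :
    (mfderiv 𝓘(ℝ, E) 𝓘(ℝ, E'') (fun z => f (k z)) q : E →L[ℝ] E'')
      = (mfderiv 𝓘(ℝ, E') 𝓘(ℝ, E'') f p : E' →L[ℝ] E'').comp
          (mfderiv 𝓘(ℝ, E) 𝓘(ℝ, E') k q : E →L[ℝ] E') := by
  subst hp
  exact mfderiv_comp q hf hk

variable [Group G]

variable (E G) in
/-- The multiplication of `G` in the chart at `1`. -/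
noncomputable def chartMul (p : E × E) : E :=
  extChartAt 𝓘(ℝ, E) (1 : G)
    ((extChartAt 𝓘(ℝ, E) (1 : G)).symm p.1 * (extChartAt 𝓘(ℝ, E) (1 : G)).symm p.2)

variable (E G) in
/-- The conjugation of `G` in the chart at `1`. -/
noncomputable def chartConj (p : E × E) : E :=
  extChartAt 𝓘(ℝ, E) (1 : G)
    ((extChartAt 𝓘(ℝ, E) (1 : G)).symm p.1 * (extChartAt 𝓘(ℝ, E) (1 : G)).symm p.2
      * ((extChartAt 𝓘(ℝ, E) (1 : G)).symm p.1)⁻¹)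

variable (E G) in
/-- The right division of `G` in the chart at `1`. -/
noncomputable def chartDiv (p : E × E) : E :=
  extChartAt 𝓘(ℝ, E) (1 : G)
    ((extChartAt 𝓘(ℝ, E) (1 : G)).symm p.1 * ((extChartAt 𝓘(ℝ, E) (1 : G)).symm p.2)⁻¹)

theorem eventually_chart_symm_mem {Y : Type*} [TopologicalSpace Y] {F : Y → G} {y : Y}
    (hF : ContinuousAt F y) (h1 : F y = 1) :
    ∀ᶠ z in 𝓝 y, F z ∈ (extChartAt 𝓘(ℝ, E) (1 : G)).source :=
  hF (by rw [h1]; exact extChartAt_source_mem_nhds (1 : G))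

theorem chart_comp_contDiffAt {Y : Type*} [NormedAddCommGroup Y] [NormedSpace ℝ Y] {F : Y → G}
    {y : Y} (hF : ContMDiffAt 𝓘(ℝ, Y) 𝓘(ℝ, E) ∞ F y) (h1 : F y = 1) :
    ContDiffAt ℝ ∞ (fun z => extChartAt 𝓘(ℝ, E) (1 : G) (F z)) y := by
  rw [← contMDiffAt_iff_contDiffAt]
  have h : ContMDiffAt 𝓘(ℝ, E) 𝓘(ℝ, E) ∞ (extChartAt 𝓘(ℝ, E) (1 : G)) (F y) := by
    rw [h1]; exact contMDiffAt_extChartAt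
  exact h.comp y hF

variable [LieGroup 𝓘(ℝ, E) ∞ G]

theorem chart_symm_comp_contMDiffAt {Y : Type*} [NormedAddCommGroup Y] [NormedSpace ℝ Y]
    {c : Y → E} {y : Y} (hc : ContDiffAt ℝ ∞ c y)
    (h1 : c y ∈ (extChartAt 𝓘(ℝ, E) (1 : G)).target) :
    ContMDiffAt 𝓘(ℝ, Y) 𝓘(ℝ, E) ∞ (fun z => (extChartAt 𝓘(ℝ, E) (1 : G)).symm (c z)) y := by
  exact (contMDiffAt_extChartAt_symm (1 : G) h1).comp y hc.contMDiffAt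

/-- The group laws hold in the chart as long as the intermediate products stay in its domain, which
they do near the unit by continuity. -/
theorem isLocalGroup_chart :
    IsLocalGroup (extChartAt 𝓘(ℝ, E) (1 : G) 1) (chartMul E G) (chartConj E G) (chartDiv E G) := by
  set e := extChartAt 𝓘(ℝ, E) (1 : G) with he
  have h1 : e.symm (e 1) = 1 := extChartAt_to_inv 1
  have ht : e.target ∈ 𝓝 (e 1) := extChartAt_target_mem_nhds 1
  have hfst : ContMDiffAt 𝓘(ℝ, E × E) 𝓘(ℝ, E) ∞ (fun p : E × E => e.symm p.1) (e 1, e 1) :=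
    chart_symm_comp_contMDiffAt contDiffAt_fst (mem_extChartAt_target (1 : G))
  have hsnd : ContMDiffAt 𝓘(ℝ, E × E) 𝓘(ℝ, E) ∞ (fun p : E × E => e.symm p.2) (e 1, e 1) :=
    chart_symm_comp_contMDiffAt contDiffAt_snd (mem_extChartAt_target (1 : G))
  have hle : (2 : ℕ∞ω) ≤ ∞ := ENat.LEInfty.out
  have hc : ContMDiffAt 𝓘(ℝ, E × E) 𝓘(ℝ, E) ∞
      (fun p : E × E => e.symm p.1 * e.symm p.2 * (e.symm p.1)⁻¹) (e 1, e 1) :=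
    (hfst.mul hsnd).mul hfst.inv
  have hd : ContMDiffAt 𝓘(ℝ, E × E) 𝓘(ℝ, E) ∞
      (fun p : E × E => e.symm p.1 * (e.symm p.2)⁻¹) (e 1, e 1) := hfst.mul hsnd.inv
  refine ⟨?_, ?_, ?_, ?_, ?_, ?_, ?_, ?_, ?_⟩
  · exact (chart_comp_contDiffAt (hfst.mul hsnd) (by simp [h1])).of_le hle
  · exact (chart_comp_contDiffAt hc (by simp [h1])).of_le hle
  · exact (chart_comp_contDiffAt hd (by simp [h1])).of_le hle
  · filter_upwards [ht] with x hx
    simp only [chartMul, ← he, h1, _root_.mul_one]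
    exact e.right_inv hx
  · filter_upwards [ht] with x hx
    simp only [chartMul, ← he, h1, _root_.one_mul]
    exact e.right_inv hx
  · filter_upwards with x
    simp only [chartConj, ← he, h1, _root_.mul_one, mul_inv_cancel]
  · filter_upwards with x
    simp only [chartDiv, ← he, mul_inv_cancel]
  · filter_upwards [eventually_chart_symm_mem (E := E) hc.continuousAt (by simp [h1])] with p hp
    simp only [chartMul, chartConj, ← he]
    rw [e.left_inv hp, inv_mul_cancel_right]
  · filter_upwards [eventually_chart_symm_mem (E := E) hd.continuousAt (by simp [h1]),
      continuousAt_fst ht] with p hp hp'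
    simp only [chartMul, chartDiv, ← he]
    rw [e.left_inv hp, inv_mul_cancel_right]
    exact e.right_inv hp'

theorem mdifferentiable_conj (g : G) :
    MDifferentiable 𝓘(ℝ, E) 𝓘(ℝ, E) (fun h : G => g * h * g⁻¹) :=
  ((contMDiff_const.mul contMDiff_id).mul contMDiff_const :
    ContMDiff 𝓘(ℝ, E) 𝓘(ℝ, E) ∞ (fun h : G => g * h * g⁻¹)).mdifferentiable (by simp)

theorem mdifferentiable_mul_right' (g : G) :
    MDifferentiable 𝓘(ℝ, E) 𝓘(ℝ, E) (fun h : G => h * g) :=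
  (contMDiff_id.mul contMDiff_const :
    ContMDiff 𝓘(ℝ, E) 𝓘(ℝ, E) ∞ (fun h : G => h * g)).mdifferentiable (by simp)

theorem lieAd_mul (g h : G) : (lieAd (E := E) (g * h)) = (lieAd g).comp (lieAd h) := by
  have e : (fun x : G => g * h * x * (g * h)⁻¹) = fun x => g * (h * x * h⁻¹) * g⁻¹ := by
    funext x; group
  unfold lieAd
  rw [e]
  exact mfderiv_comp_of_eq_model (f := fun x : G => g * x * g⁻¹) (by simp)
    (mdifferentiable_conj g 1) (mdifferentiable_conj h 1)

/-- The pulled back Maurer-Cartan form at a point is the differential of a right translate. -/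
theorem maurerCartan_comp_mfderiv {g : X → G} {y : X}
    (hg : MDifferentiableAt 𝓘(ℝ, X) 𝓘(ℝ, E) g y) :
    ((maurerCartan (E := E) (g y)).comp (mfderiv 𝓘(ℝ, X) 𝓘(ℝ, E) g y) : X →L[ℝ] E)
      = (mfderiv 𝓘(ℝ, X) 𝓘(ℝ, E) (fun z => g z * (g y)⁻¹) y : X →L[ℝ] E) :=
  (mfderiv_comp_of_eq_model (f := fun h : G => h * (g y)⁻¹) rfl
    (mdifferentiable_mul_right' (g y)⁻¹ (g y)) hg).symm

/-- `g`, right translated to take the value `1` at `y₀`, in the chart at `1`. -/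
noncomputable def chartTranslate (E : Type*) {G X : Type*} [NormedAddCommGroup E] [NormedSpace ℝ E]
    [TopologicalSpace G] [ChartedSpace E G] [Group G] (g : X → G) (y₀ y : X) : E :=
  extChartAt 𝓘(ℝ, E) (1 : G) (g y * (g y₀)⁻¹)

theorem contMDiffAt_translate {g : X → G} {y₀ : X} (h : G)
    (hg : ContMDiffAt 𝓘(ℝ, X) 𝓘(ℝ, E) ∞ g y₀) :
    ContMDiffAt 𝓘(ℝ, X) 𝓘(ℝ, E) ∞ (fun y => g y * h) y₀ :=
  hg.mul contMDiffAt_const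

theorem contDiffAt_chartTranslate {g : X → G} {y₀ : X}
    (hg : ContMDiffAt 𝓘(ℝ, X) 𝓘(ℝ, E) ∞ g y₀) : ContDiffAt ℝ ∞ (chartTranslate E g y₀) y₀ :=
  chart_comp_contDiffAt (contMDiffAt_translate _ hg) (by simp)

omit [NormedAddCommGroup X] [NormedSpace ℝ X] [LieGroup 𝓘(ℝ, E) ∞ G] in
theorem chartTranslate_self (g : X → G) (y₀ : X) :
    chartTranslate E g y₀ y₀ = extChartAt 𝓘(ℝ, E) (1 : G) 1 := by
  simp only [chartTranslate, mul_inv_cancel]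

theorem eventually_chart_symm_chartTranslate {g : X → G} {y₀ : X}
    (hg : ContMDiffAt 𝓘(ℝ, X) 𝓘(ℝ, E) ∞ g y₀) :
    ∀ᶠ y in 𝓝 y₀, (extChartAt 𝓘(ℝ, E) (1 : G)).symm (chartTranslate E g y₀ y)
      = g y * (g y₀)⁻¹ := by
  filter_upwards [eventually_chart_symm_mem (E := E)
    (contMDiffAt_translate (g y₀)⁻¹ hg).continuousAt (by simp)] with y hy
  exact (extChartAt 𝓘(ℝ, E) (1 : G)).left_inv hy

theorem maurerCartan_eq_fderiv_chartTranslate {g : X → G} {y₀ : X}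
    (hg : ContMDiffAt 𝓘(ℝ, X) 𝓘(ℝ, E) ∞ g y₀) :
    ((maurerCartan (E := E) (g y₀)).comp (mfderiv 𝓘(ℝ, X) 𝓘(ℝ, E) g y₀) : X →L[ℝ] E)
      = fderiv ℝ (chartTranslate E g y₀) y₀ := by
  rw [maurerCartan_comp_mfderiv (hg.mdifferentiableAt (by simp))]
  exact mfderiv_eq_fderiv_extChartAt (mul_inv_cancel _)
    ((contMDiffAt_translate (g y₀)⁻¹ hg).mdifferentiableAt (by simp))

/-- Right invariance allows `g` to be replaced by `z ↦ g z * (g y₀)⁻¹`, which stays in the chart at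
`1` near `y₀`. The form at `y` is then the derivative at `z = y` of the quotient of the translates
at `z` and `y`, that is, of `chartDiv` in its first argument. -/
theorem maurerCartan_eventuallyEq {g : X → G} {y₀ : X}
    (hg : ContMDiffAt 𝓘(ℝ, X) 𝓘(ℝ, E) ∞ g y₀) :
    (fun y => ((maurerCartan (E := E) (g y)).comp (mfderiv 𝓘(ℝ, X) 𝓘(ℝ, E) g y) : X →L[ℝ] E))
      =ᶠ[𝓝 y₀] fun y => ((fderiv ℝ (chartDiv E G)
          (chartTranslate E g y₀ y, chartTranslate E g y₀ y)).comp
            (ContinuousLinearMap.inl ℝ E E)).comp (fderiv ℝ (chartTranslate E g y₀) y) := by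
  have hg2 : ∀ᶠ y in 𝓝 y₀, ContMDiffAt 𝓘(ℝ, X) 𝓘(ℝ, E) 2 g y :=
    (contMDiffAt_iff_contMDiffAt_nhds (by simp)).mp (hg.of_le ENat.LEInfty.out)
  have hκ := contDiffAt_chartTranslate hg
  have hκ2 : ∀ᶠ y in 𝓝 y₀, ContDiffAt ℝ 2 (chartTranslate E g y₀) y :=
    (hκ.of_le ENat.LEInfty.out).eventually (by simp)
  have hδ : ∀ᶠ p in 𝓝 (chartTranslate E g y₀ y₀, chartTranslate E g y₀ y₀),
      ContDiffAt ℝ 2 (chartDiv E G) p := by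
    rw [chartTranslate_self]
    exact (isLocalGroup_chart (E := E) (G := G)).contDiffAt_div.eventually (by simp)
  have hk := eventually_chart_symm_chartTranslate hg
  filter_upwards [hg2, hκ2, (hκ.continuousAt.prodMk hκ.continuousAt).eventually hδ, hk,
    hk.eventually_nhds] with y h1 h2 h3 h4 h5
  rw [maurerCartan_comp_mfderiv (h1.mdifferentiableAt (by simp))]
  have hr : MDifferentiableAt 𝓘(ℝ, X) 𝓘(ℝ, E) (fun z => g z * (g y)⁻¹) y :=
    (mdifferentiable_mul_right' (E := E) (g y)⁻¹ (g y)).comp y (h1.mdifferentiableAt (by simp))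
  refine (mfderiv_eq_fderiv_extChartAt (f := fun z => g z * (g y)⁻¹) (mul_inv_cancel _) hr).trans ?_
  have heq : (extChartAt 𝓘(ℝ, E) (1 : G) ∘ fun z => g z * (g y)⁻¹) =ᶠ[𝓝 y]
      fun z => chartDiv E G (chartTranslate E g y₀ z, chartTranslate E g y₀ y) := by
    filter_upwards [h5] with z hz
    simp only [Function.comp_apply, chartDiv, hz, h4]
    congr 1
    group
  rw [heq.fderiv_eq]
  have h6 := HasFDerivAt.comp (f := fun z => (chartTranslate E g y₀ z, chartTranslate E g y₀ y)) y
    (h3.differentiableAt (by simp)).hasFDerivAt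
    ((h2.differentiableAt (by simp)).hasFDerivAt.prodMk (hasFDerivAt_const _ y))
  refine h6.fderiv.trans ?_
  ext v
  simp

theorem lieAd_chart_symm :
    ∀ᶠ x in 𝓝 (extChartAt 𝓘(ℝ, E) (1 : G) 1),
    (lieAd (E := E) ((extChartAt 𝓘(ℝ, E) (1 : G)).symm x) : E →L[ℝ] E)
      = (fderiv ℝ (chartConj E G) (x, extChartAt 𝓘(ℝ, E) (1 : G) 1)).comp
          (ContinuousLinearMap.inr ℝ E E) := by
  have hA := (isLocalGroup_chart (E := E) (G := G)).contDiffAt_conj.eventually (by simp)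
  have hc : ContinuousAt (fun x : E => (x, extChartAt 𝓘(ℝ, E) (1 : G) 1))
    (extChartAt 𝓘(ℝ, E) (1 : G) 1) := by fun_prop
  filter_upwards [hc.eventually hA] with x hx
  refine (mfderiv_eq_fderiv_extChartAt_symm (p := (1 : G)) (by simp)
    (mdifferentiable_conj _ 1)).trans ?_
  have h6 := HasFDerivAt.comp (f := fun z => (x, z)) (extChartAt 𝓘(ℝ, E) (1 : G) 1)
    (hx.differentiableAt (by simp)).hasFDerivAt
    ((hasFDerivAt_const x _).prodMk (hasFDerivAt_id _))
  refine h6.fderiv.trans ?_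
  ext v
  simp

/-- In the chart, the left-invariant field of `u` is `x ↦ ∂₂μ(x, o) u`. This links the bracket of
the Lie algebra, defined through invariant vector fields, to second derivatives of `chartMul`. -/
theorem mpullback_mulInvariantVectorField_chart (u : GroupLieAlgebra 𝓘(ℝ, E) G) :
    ∀ᶠ x in 𝓝 (extChartAt 𝓘(ℝ, E) (1 : G) 1),
      (VectorField.mpullbackWithin 𝓘(ℝ, E) 𝓘(ℝ, E) (extChartAt 𝓘(ℝ, E) (1 : G)).symm
        (mulInvariantVectorField u) (Set.range 𝓘(ℝ, E)) x : E)
      = fderiv ℝ (chartMul E G) (x, extChartAt 𝓘(ℝ, E) (1 : G) 1) (0, (u : E)) := by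
  have hμ := (isLocalGroup_chart (E := E) (G := G)).contDiffAt_mul.eventually (by simp)
  have hc : ContinuousAt (fun x : E => (x, extChartAt 𝓘(ℝ, E) (1 : G) 1))
    (extChartAt 𝓘(ℝ, E) (1 : G) 1) := by fun_prop
  filter_upwards [extChartAt_target_mem_nhds (I := 𝓘(ℝ, E)) (1 : G), hc.eventually hμ] with x hx h2
  have hsrc : (extChartAt 𝓘(ℝ, E) (1 : G)).symm x ∈ (chartAt E (1 : G)).source := by
    rw [← extChartAt_source 𝓘(ℝ, E)]
    exact (extChartAt 𝓘(ℝ, E) (1 : G)).map_target hx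
  have : IsManifold 𝓘(ℝ, E) 1 G := IsManifold.of_le (n := ∞) ENat.LEInfty.out
  have hinv : (mfderivWithin 𝓘(ℝ, E) 𝓘(ℝ, E) (extChartAt 𝓘(ℝ, E) (1 : G)).symm
      (Set.range 𝓘(ℝ, E)) x).inverse
      = mfderiv 𝓘(ℝ, E) 𝓘(ℝ, E) (extChartAt 𝓘(ℝ, E) (1 : G))
          ((extChartAt 𝓘(ℝ, E) (1 : G)).symm x) :=
    ContinuousLinearMap.inverse_eq (mfderivWithin_extChartAt_symm_comp_mfderiv_extChartAt hx)
      (mfderiv_extChartAt_comp_mfderivWithin_extChartAt_symm hx)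
  rw [VectorField.mpullbackWithin_apply, hinv]
  set p := (extChartAt 𝓘(ℝ, E) (1 : G)).symm x with hp
  have hL : MDifferentiable 𝓘(ℝ, E) 𝓘(ℝ, E) (fun h : G => p * h) :=
    (contMDiff_mul_left : ContMDiff 𝓘(ℝ, E) 𝓘(ℝ, E) ∞ (fun h : G => p * h)).mdifferentiable
      (by simp)
  have he : MDifferentiableAt 𝓘(ℝ, E) 𝓘(ℝ, E) (extChartAt 𝓘(ℝ, E) (1 : G)) p :=
    mdifferentiableAt_extChartAt hsrc
  have hcomp := mfderiv_comp_of_eq_model (k := fun h : G => p * h) (q := 1) (mul_one p) he (hL 1)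
  have he' : MDifferentiableAt 𝓘(ℝ, E) 𝓘(ℝ, E) (extChartAt 𝓘(ℝ, E) (1 : G)) (p * 1) := by
    rwa [mul_one]
  have h3 := mfderiv_eq_fderiv_extChartAt_symm (q := (1 : G))
    (p := extChartAt 𝓘(ℝ, E) (1 : G) (p * 1)) rfl
    (f := fun h : G => extChartAt 𝓘(ℝ, E) (1 : G) (p * h))
    (MDifferentiableAt.comp (1 : G) he' (hL 1))
  refine (congrArg (fun L : E →L[ℝ] E => L u) (hcomp.symm.trans h3)).trans ?_
  have h6 := HasFDerivAt.comp (f := fun z => (x, z)) (extChartAt 𝓘(ℝ, E) (1 : G) 1)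
    (h2.differentiableAt (by simp)).hasFDerivAt
    ((hasFDerivAt_const x _).prodMk (hasFDerivAt_id _))
  have h7 := congrArg (fun L : E →L[ℝ] E => L u) h6.fderiv
  simp only [extChartAt_model_space_eq_id, PartialEquiv.refl_coe, Function.id_comp]
  exact h7

/-- The Lie bracket is computed by the mixed second derivative of the multiplication. -/
theorem bracket_eq_localBracket (v w : GroupLieAlgebra 𝓘(ℝ, E) G) :
    ⁅v, w⁆ = localBracket (extChartAt 𝓘(ℝ, E) (1 : G) 1) (chartMul E G) v w := by
  have hG := isLocalGroup_chart (E := E) (G := G)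
  have : IsManifold 𝓘(ℝ, E) 1 G := IsManifold.of_le (n := ∞) ENat.LEInfty.out
  rw [GroupLieAlgebra.bracket_def]
  set o := extChartAt 𝓘(ℝ, E) (1 : G) 1
  have hD : ∀ u : E, ∃ L : E →L[ℝ] E,
      HasFDerivAt (fun x => fderiv ℝ (chartMul E G) (x, o) (0, u)) L o ∧
      ∀ t, L t = fderiv ℝ (fderiv ℝ (chartMul E G)) (o, o) (t, 0) (0, u) := fun u => by
    obtain ⟨K, hK, hK'⟩ := hG.contDiffAt_mul.hasFDerivAt_fderiv_comp (c := fun x => (x, o))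
      (x := o) ((hasFDerivAt_id o).prodMk (hasFDerivAt_const o o)) (ContinuousLinearMap.inr ℝ E E)
    refine ⟨_, hK.clm_apply (hasFDerivAt_const u o), fun t => ?_⟩
    simp [hK']
  have hVe := mpullback_mulInvariantVectorField_chart (E := E) (G := G) v
  have hWe := mpullback_mulInvariantVectorField_chart (E := E) (G := G) w
  have hB : ∀ v w : E, VectorField.lieBracket ℝ (fun x => fderiv ℝ (chartMul E G) (x, o) (0, v))
      (fun x => fderiv ℝ (chartMul E G) (x, o) (0, w)) o = localBracket o (chartMul E G) v w := by
    intro v w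
    obtain ⟨V', hV, hV'⟩ := hD v
    obtain ⟨W', hW, hW'⟩ := hD w
    rw [VectorField.lieBracket_eq]
    change fderiv ℝ _ o (fderiv ℝ (chartMul E G) (o, o) (0, v))
      - fderiv ℝ _ o (fderiv ℝ (chartMul E G) (o, o) (0, w)) = _
    rw [hV.fderiv, hW.fderiv, hG.fderiv_mul_inr, hG.fderiv_mul_inr, hV', hW']
    rfl
  have hset : (extChartAt 𝓘(ℝ, E) (1 : G)).symm ⁻¹' Set.univ ∩ Set.range 𝓘(ℝ, E) = Set.univ := by
    simp
  -- A chart has identity derivative at its own base point, so the bracket on the manifold at `1` is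
  -- the bracket of the chart expressions.
  have hid : ((mfderiv 𝓘(ℝ, E) 𝓘(ℝ, E) (extChartAt 𝓘(ℝ, E) (1 : G)) 1).inverse : E →L[ℝ] E)
      = ContinuousLinearMap.id ℝ E :=
    (congrArg (fun L : E →L[ℝ] E => L.inverse) mfderiv_extChartAt_self).trans
      ContinuousLinearMap.inverse_id
  refine (congrArg (fun L : E →L[ℝ] E => L _) hid).trans ?_
  refine (congrArg (fun s => VectorField.lieBracketWithin ℝ _ _ s o) hset).trans ?_
  refine (congrFun VectorField.lieBracketWithin_univ o).trans ?_
  exact (Filter.EventuallyEq.lieBracket_vectorField_eq hVe hWe).trans (hB v w)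

end LieGroupCharts

/-! ### Derivatives of representations along maps into the group. -/

section Representations

variable {E G X V N : Type*} [NormedAddCommGroup E] [NormedSpace ℝ E]
  [TopologicalSpace G] [ChartedSpace E G] [Group G]
  [NormedAddCommGroup X] [NormedSpace ℝ X] [NormedAddCommGroup V] [NormedSpace ℝ V]
  [NormedAddCommGroup N] [NormedSpace ℝ N]

theorem HasFDerivAt.clm_comp_consts {c : X → V →L[ℝ] V} {c' : X →L[ℝ] V →L[ℝ] V} {y : X}
    (hc : HasFDerivAt c c' y) (S T : V →L[ℝ] V) :
    ∃ L : X →L[ℝ] V →L[ℝ] V, HasFDerivAt (fun z => S.comp ((c z).comp T)) L y ∧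
      ∀ v m, L v m = S (c' v (T m)) := by
  refine ⟨_, (hasFDerivAt_const S y).clm_comp (hc.clm_comp (hasFDerivAt_const T y)),
    fun v m => ?_⟩
  simp

theorem mfderiv_of_hasFDerivAt_chart [LieGroup 𝓘(ℝ, E) ∞ G] {ρ : G → N} {D : E →L[ℝ] N}
    (h : HasFDerivAt (fun x => ρ ((extChartAt 𝓘(ℝ, E) (1 : G)).symm x)) D
      (extChartAt 𝓘(ℝ, E) (1 : G) 1)) :
    (mfderiv 𝓘(ℝ, E) 𝓘(ℝ, N) ρ 1 : E →L[ℝ] N) = D := by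
  have hd : MDifferentiableAt 𝓘(ℝ, E) 𝓘(ℝ, N) ρ 1 := by
    have : IsManifold 𝓘(ℝ, E) 1 G := IsManifold.of_le (n := ∞) ENat.LEInfty.out
    have h1 := h.differentiableAt.mdifferentiableAt.comp (1 : G)
      (mdifferentiableAt_extChartAt (I := 𝓘(ℝ, E)) (mem_chart_source E (1 : G)))
    refine h1.congr_of_eventuallyEq ?_
    filter_upwards [extChartAt_source_mem_nhds (I := 𝓘(ℝ, E)) (1 : G)] with x hx
    simp only [Function.comp_apply]
    rw [(extChartAt 𝓘(ℝ, E) (1 : G)).left_inv hx]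
  refine (mfderiv_eq_fderiv_extChartAt_symm rfl hd).trans ?_
  simp only [extChartAt_model_space_eq_id, PartialEquiv.refl_coe, Function.id_comp]
  exact h.fderiv

/-- A multiplicative operator-valued function on `G`, differentiable at `1` with derivative `D` in
the chart at `1`. -/
structure IsDifferentiableRep (ρ : G → V →L[ℝ] V) (D : E →L[ℝ] V →L[ℝ] V) : Prop where
  map_one : ρ 1 = ContinuousLinearMap.id ℝ V
  map_mul : ∀ g h, ρ (g * h) = (ρ g).comp (ρ h)
  hasFDerivAt : HasFDerivAt (fun x => ρ ((extChartAt 𝓘(ℝ, E) (1 : G)).symm x)) D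
    (extChartAt 𝓘(ℝ, E) (1 : G) 1)

namespace IsDifferentiableRep

variable {ρ : G → V →L[ℝ] V} {D : E →L[ℝ] V →L[ℝ] V}

theorem hasFDerivAt_comp_of_eq_one (h : IsDifferentiableRep ρ D) {k : X → G} {y : X}
    (hk : ContMDiffAt 𝓘(ℝ, X) 𝓘(ℝ, E) ∞ k y) (h1 : k y = 1) :
    HasFDerivAt (fun z => ρ (k z)) (D.comp (mfderiv 𝓘(ℝ, X) 𝓘(ℝ, E) k y : X →L[ℝ] E)) y := by
  have hκ : HasFDerivAt (fun z => extChartAt 𝓘(ℝ, E) (1 : G) (k z))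
      (mfderiv 𝓘(ℝ, X) 𝓘(ℝ, E) k y : X →L[ℝ] E) y := by
    rw [mfderiv_eq_fderiv_extChartAt h1 (hk.mdifferentiableAt (by simp))]
    exact ((chart_comp_contDiffAt hk h1).differentiableAt (by simp)).hasFDerivAt
  have h2 : HasFDerivAt (fun x => ρ ((extChartAt 𝓘(ℝ, E) (1 : G)).symm x)) D
      (extChartAt 𝓘(ℝ, E) (1 : G) (k y)) := by rw [h1]; exact h.hasFDerivAt
  refine (h2.comp y hκ).congr_of_eventuallyEq ?_
  filter_upwards [eventually_chart_symm_mem (E := E) hk.continuousAt h1] with z hz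
  simp only [Function.comp_apply]
  rw [(extChartAt 𝓘(ℝ, E) (1 : G)).left_inv hz]

/-- The derivative of a representation along a map into the group, by means of the pulled back
Maurer-Cartan form. -/
theorem exists_hasFDerivAt_comp [LieGroup 𝓘(ℝ, E) ∞ G] (h : IsDifferentiableRep ρ D) {g : X → G} {y : X}
    (hg : ContMDiffAt 𝓘(ℝ, X) 𝓘(ℝ, E) ∞ g y) :
    ∃ L : X →L[ℝ] V →L[ℝ] V, HasFDerivAt (fun z => ρ (g z)) L y ∧
      ∀ v m, L v m = D (((maurerCartan (E := E) (g y)).comp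
        (mfderiv 𝓘(ℝ, X) 𝓘(ℝ, E) g y) : X →L[ℝ] E) v) (ρ (g y) m) := by
  -- Writing `ρ (g z) = ρ (g z * (g y)⁻¹) ∘ ρ (g y)` reduces to differentiability at `1`; the
  -- derivative of the translate is the pulled back Maurer-Cartan form.
  have h1 := h.hasFDerivAt_comp_of_eq_one (contMDiffAt_translate (g y)⁻¹ hg) (mul_inv_cancel _)
  rw [← maurerCartan_comp_mfderiv (hg.mdifferentiableAt (by simp))] at h1
  obtain ⟨L, hL, hL'⟩ := h1.clm_comp_consts (ContinuousLinearMap.id ℝ V) (ρ (g y))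
  refine ⟨L, hL.congr_of_eventuallyEq (Filter.Eventually.of_forall fun z => ?_), hL'⟩
  simp only [← h.map_mul, inv_mul_cancel_right, ContinuousLinearMap.id_comp]

theorem apply_inv (h : IsDifferentiableRep ρ D) (g : G) (m : V) : ρ g (ρ g⁻¹ m) = m := by
  have := h.map_mul g g⁻¹
  rw [mul_inv_cancel, h.map_one] at this
  exact (congrArg (fun L : V →L[ℝ] V => L m) this).symm

theorem inv_apply (h : IsDifferentiableRep ρ D) (g : G) (m : V) : ρ g⁻¹ (ρ g m) = m := by
  have := h.apply_inv g⁻¹ m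
  rwa [inv_inv] at this

/-- Differentiate `ρ (g x g⁻¹) = ρ g ∘ ρ x ∘ ρ g⁻¹` at `x = 1`. For `ρ = Ad` it says that `Ad_g`
preserves the bracket, for `ρ = Γ.push` that `(Φ_g)_*` intertwines the infinitesimal action. -/
theorem map_lieAd [LieGroup 𝓘(ℝ, E) ∞ G] (h : IsDifferentiableRep ρ D) (g : G) (u : E) (m : V) :
    D ((lieAd (E := E) g : E →L[ℝ] E) u) (ρ g m) = ρ g (D u m) := by
  have hs : ContMDiffAt 𝓘(ℝ, E) 𝓘(ℝ, E) ∞ (extChartAt 𝓘(ℝ, E) (1 : G)).symm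
      (extChartAt 𝓘(ℝ, E) (1 : G) 1) :=
    contMDiffAt_extChartAt_symm (1 : G) (mem_extChartAt_target (1 : G))
  have hk : ContMDiffAt 𝓘(ℝ, E) 𝓘(ℝ, E) ∞
      (fun x => g * (extChartAt 𝓘(ℝ, E) (1 : G)).symm x * g⁻¹) (extChartAt 𝓘(ℝ, E) (1 : G) 1) :=
    (contMDiffAt_const.mul hs).mul contMDiffAt_const
  have h1 : g * (extChartAt 𝓘(ℝ, E) (1 : G)).symm (extChartAt 𝓘(ℝ, E) (1 : G) 1) * g⁻¹ = 1 := by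
    rw [extChartAt_to_inv]; simp
  obtain ⟨A, hA⟩ : ∃ A : E →L[ℝ] E, A = lieAd (E := E) g := ⟨_, rfl⟩
  have hAd : (mfderiv 𝓘(ℝ, E) 𝓘(ℝ, E) (fun x => g * (extChartAt 𝓘(ℝ, E) (1 : G)).symm x * g⁻¹)
      (extChartAt 𝓘(ℝ, E) (1 : G) 1) : E →L[ℝ] E) = A := by
    refine (mfderiv_eq_fderiv_extChartAt
      (f := fun x => g * (extChartAt 𝓘(ℝ, E) (1 : G)).symm x * g⁻¹) h1
      (hk.mdifferentiableAt (by simp))).trans ?_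
    exact (mfderiv_eq_fderiv_extChartAt_symm (p := (1 : G)) (by simp)
      (mdifferentiable_conj g 1)).symm.trans hA.symm
  have hd : HasFDerivAt (fun x => ρ (g * (extChartAt 𝓘(ℝ, E) (1 : G)).symm x * g⁻¹)) (D.comp A)
      (extChartAt 𝓘(ℝ, E) (1 : G) 1) := hAd ▸ h.hasFDerivAt_comp_of_eq_one hk h1
  rw [← hA]
  obtain ⟨L, hL, hL'⟩ := h.hasFDerivAt.clm_comp_consts (ρ g) (ρ g⁻¹)
  have heq := hd.unique (hL.congr_of_eventuallyEq (Filter.Eventually.of_forall fun x => by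
    simp only [h.map_mul, ContinuousLinearMap.comp_assoc]))
  have h3 := (congrArg (fun L : E →L[ℝ] V →L[ℝ] V => L u (ρ g m)) heq).trans (hL' u (ρ g m))
  rw [h.inv_apply] at h3
  exact h3

end IsDifferentiableRep

theorem lieAd_one : lieAd (E := E) (1 : G) = ContinuousLinearMap.id ℝ _ := by
  have e : (fun h : G => 1 * h * 1⁻¹) = id := by funext h; simp
  unfold lieAd
  rw [e]
  exact mfderiv_id

/-- The adjoint representation is differentiable with derivative the bracket. -/
theorem lieAd_isDifferentiableRep [FiniteDimensional ℝ E] [LieGroup 𝓘(ℝ, E) ∞ G] :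
    IsDifferentiableRep (E := E) (G := G) (V := GroupLieAlgebra 𝓘(ℝ, E) G) lieAd
      (lieBracketCLM E G) := by
  refine ⟨lieAd_one, lieAd_mul, ?_⟩
  obtain ⟨L, hL, hL'⟩ := (isLocalGroup_chart (E := E) (G := G)).conj_hasFDerivAt
  have e : L = (lieBracketCLM E G : E →L[ℝ] E →L[ℝ] E) := by
    ext w v
    rw [hL']
    exact (bracket_eq_localBracket (E := E) (G := G) w v).symm
  rw [e] at hL
  exact hL.congr_of_eventuallyEq lieAd_chart_symm

end Representations

/-! ### The Maurer-Cartan equation for a pulled back form. -/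

section MaurerCartan

variable {E G X : Type*} [NormedAddCommGroup E] [NormedSpace ℝ E]
  [TopologicalSpace G] [ChartedSpace E G] [Group G]
  [NormedAddCommGroup X] [NormedSpace ℝ X]

variable (E) in
/-- The pullback of the right-invariant Maurer-Cartan form along a map on a normed space. -/
noncomputable def mcForm (g : X → G) (y : X) : X [⋀^Fin 1]→L[ℝ] GroupLieAlgebra 𝓘(ℝ, E) G :=
  ContinuousAlternatingMap.ofSubsingleton ℝ X (GroupLieAlgebra 𝓘(ℝ, E) G) (0 : Fin 1)
    ((maurerCartan (E := E) (g y)).comp (mfderiv 𝓘(ℝ, X) 𝓘(ℝ, E) g y))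

theorem mcForm_apply (g : X → G) (y v : X) :
    mcForm E g y ![v] = ((maurerCartan (E := E) (g y)).comp (mfderiv 𝓘(ℝ, X) 𝓘(ℝ, E) g y) :
      X →L[ℝ] GroupLieAlgebra 𝓘(ℝ, E) G) v := rfl

/-- The second-order expansion of the pullback of a one-form with values in operators. -/
theorem exists_hasFDerivAt_clm_comp_fderiv {κ : X → E} {T : E → E →L[ℝ] E}
    {T' : E →L[ℝ] E →L[ℝ] E} {y : X} (hκ : ContDiffAt ℝ 2 κ y) (hT : HasFDerivAt T T' (κ y))
    (hT1 : T (κ y) = ContinuousLinearMap.id ℝ E) :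
    ∃ L : X →L[ℝ] X →L[ℝ] E, HasFDerivAt (fun z => (T (κ z)).comp (fderiv ℝ κ z)) L y ∧
      ∀ v w, L v w - L w v
        = T' (fderiv ℝ κ y v) (fderiv ℝ κ y w) - T' (fderiv ℝ κ y w) (fderiv ℝ κ y v) := by
  have h1 := (hκ.differentiableAt (by simp)).hasFDerivAt
  have h2 : HasFDerivAt (fderiv ℝ κ) (fderiv ℝ (fderiv ℝ κ) y) y :=
    ((hκ.fderiv_right (m := 1) (by norm_num)).differentiableAt (by simp)).hasFDerivAt
  refine ⟨_, (hT.comp y h1).clm_comp h2, fun v w => ?_⟩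
  have hs := (hκ.isSymmSndFDerivAt (by simp)) v w
  simp [hT1, hs]

/-- Near `y` the form is `T ∘ dκ`, where `κ` is the translate of `g` in the chart and `T x = ∂₁δ(x,
x)`. The second derivative of `κ` is symmetric and disappears on antisymmetrizing, which leaves the
derivative of `T`, the bracket. The sign is that of the right-invariant form. -/
theorem mcForm_structure [LieGroup 𝓘(ℝ, E) ∞ G] [FiniteDimensional ℝ E] {g : X → G} {y : X}
    (hg : ContMDiffAt 𝓘(ℝ, X) 𝓘(ℝ, E) ∞ g y) :
    DifferentiableAt ℝ (mcForm E g) y ∧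
    ∀ v w, extDeriv (mcForm E g) y ![v, w]
      = lieBracketCLM E G (mcForm E g y ![v]) (mcForm E g y ![w]) := by
  obtain ⟨hT1, T', hT', hTB⟩ := (isLocalGroup_chart (E := E) (G := G)).div_hasFDerivAt
  rw [← chartTranslate_self (E := E) g y] at hT1 hT'
  obtain ⟨L, hL, hL'⟩ := exists_hasFDerivAt_clm_comp_fderiv
    (T := fun x => (fderiv ℝ (chartDiv E G) (x, x)).comp (ContinuousLinearMap.inl ℝ E E))
    ((contDiffAt_chartTranslate hg).of_le ENat.LEInfty.out) hT' hT1
  have hθ := hL.congr_of_eventuallyEq (maurerCartan_eventuallyEq hg)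
  have hθ' : HasFDerivAt (mcForm E g)
      ((ContinuousAlternatingMap.ofSubsingletonLIE (𝕜 := ℝ) (E := X)
        (F := GroupLieAlgebra 𝓘(ℝ, E) G)
        (0 : Fin 1)).toContinuousLinearEquiv.toContinuousLinearMap.comp L) y :=
    (ContinuousAlternatingMap.ofSubsingletonLIE (𝕜 := ℝ) (E := X)
      (F := GroupLieAlgebra 𝓘(ℝ, E) G)
        (0 : Fin 1)).toContinuousLinearEquiv.toContinuousLinearMap.hasFDerivAt.comp y hθ
  refine ⟨hθ'.differentiableAt, fun v w => ?_⟩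
  rw [extDeriv_one_form_apply, hθ'.fderiv]
  have e := maurerCartan_eq_fderiv_chartTranslate hg
  rw [mcForm_apply, mcForm_apply]
  refine (hL' v w).trans ((hTB _ _).trans ?_)
  rw [← e]
  exact (bracket_eq_localBracket (E := E) (G := G) _ _).symm

end MaurerCartan

/-! ### Differentiating the crossed module. -/

namespace LieCrossedModule

variable {E₁ E₀ H₁ H₀ : Type*}
  [NormedAddCommGroup E₁] [NormedSpace ℝ E₁] [NormedAddCommGroup E₀] [NormedSpace ℝ E₀]
  [TopologicalSpace H₁] [ChartedSpace E₁ H₁] [Group H₁]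
  [TopologicalSpace H₀] [ChartedSpace E₀ H₀] [Group H₀]
  (Γ : LieCrossedModule E₁ E₀ H₁ H₀)

theorem mdifferentiable_Φ (g : H₀) : MDifferentiable 𝓘(ℝ, E₁) 𝓘(ℝ, E₁) (Γ.Φ g) :=
  (Γ.smooth_Φ.comp (contMDiff_const.prodMk contMDiff_id) :
    ContMDiff 𝓘(ℝ, E₁) 𝓘(ℝ, E₁) ∞ (fun h => Γ.Φ g h)).mdifferentiable (by simp)

theorem push_one : Γ.push 1 = ContinuousLinearMap.id ℝ _ := by
  have e : (Γ.Φ 1 : H₁ → H₁) = id := by funext h; simp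
  unfold push
  rw [e]
  exact mfderiv_id

theorem push_mul (g h : H₀) : Γ.push (g * h) = (Γ.push g).comp (Γ.push h) := by
  have e : (Γ.Φ (g * h) : H₁ → H₁) = fun x => Γ.Φ g (Γ.Φ h x) := by funext x; simp
  unfold push
  rw [e]
  exact mfderiv_comp_of_eq_model (f := Γ.Φ g) (k := Γ.Φ h) (map_one _)
    (Γ.mdifferentiable_Φ g 1) (Γ.mdifferentiable_Φ h 1)

/-- The action `Φ` in the charts at `1`. -/
noncomputable def chartAction (p : E₀ × E₁) : E₁ :=
  extChartAt 𝓘(ℝ, E₁) (1 : H₁) (Γ.Φ ((extChartAt 𝓘(ℝ, E₀) (1 : H₀)).symm p.1)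
    ((extChartAt 𝓘(ℝ, E₁) (1 : H₁)).symm p.2))

variable [LieGroup 𝓘(ℝ, E₁) ∞ H₁] [LieGroup 𝓘(ℝ, E₀) ∞ H₀]

theorem contDiffAt_chartAction : ContDiffAt ℝ ∞ Γ.chartAction
    (extChartAt 𝓘(ℝ, E₀) (1 : H₀) 1, extChartAt 𝓘(ℝ, E₁) (1 : H₁) 1) := by
  have h1 : ContMDiffAt 𝓘(ℝ, E₀ × E₁) 𝓘(ℝ, E₀) ∞
      (fun p : E₀ × E₁ => (extChartAt 𝓘(ℝ, E₀) (1 : H₀)).symm p.1)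
      (extChartAt 𝓘(ℝ, E₀) (1 : H₀) 1, extChartAt 𝓘(ℝ, E₁) (1 : H₁) 1) :=
    chart_symm_comp_contMDiffAt contDiffAt_fst (mem_extChartAt_target (1 : H₀))
  have h2 : ContMDiffAt 𝓘(ℝ, E₀ × E₁) 𝓘(ℝ, E₁) ∞
      (fun p : E₀ × E₁ => (extChartAt 𝓘(ℝ, E₁) (1 : H₁)).symm p.2)
      (extChartAt 𝓘(ℝ, E₀) (1 : H₀) 1, extChartAt 𝓘(ℝ, E₁) (1 : H₁) 1) :=
    chart_symm_comp_contMDiffAt contDiffAt_snd (mem_extChartAt_target (1 : H₁))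
  refine chart_comp_contDiffAt (F := fun p : E₀ × E₁ =>
    Γ.Φ ((extChartAt 𝓘(ℝ, E₀) (1 : H₀)).symm p.1) ((extChartAt 𝓘(ℝ, E₁) (1 : H₁)).symm p.2)) ?_ ?_
  · exact Γ.smooth_Φ.contMDiffAt.comp _ (h1.prodMk h2)
  · simp only [extChartAt_to_inv, map_one]

theorem push_chart_symm :
    ∀ᶠ x in 𝓝 (extChartAt 𝓘(ℝ, E₀) (1 : H₀) 1),
    (Γ.push ((extChartAt 𝓘(ℝ, E₀) (1 : H₀)).symm x) : E₁ →L[ℝ] E₁)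
      = (fderiv ℝ Γ.chartAction (x, extChartAt 𝓘(ℝ, E₁) (1 : H₁) 1)).comp
          (ContinuousLinearMap.inr ℝ E₀ E₁) := by
  have hA := (Γ.contDiffAt_chartAction.of_le (m := 2) ENat.LEInfty.out).eventually (by simp)
  have hc : ContinuousAt (fun x : E₀ => (x, extChartAt 𝓘(ℝ, E₁) (1 : H₁) 1))
    (extChartAt 𝓘(ℝ, E₀) (1 : H₀) 1) := by fun_prop
  filter_upwards [hc.eventually hA] with x hx
  refine (mfderiv_eq_fderiv_extChartAt_symm (p := (1 : H₁)) (map_one _)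
    (Γ.mdifferentiable_Φ _ 1)).trans ?_
  have h6 := HasFDerivAt.comp (f := fun z => (x, z)) (extChartAt 𝓘(ℝ, E₁) (1 : H₁) 1)
    (hx.differentiableAt (by simp)).hasFDerivAt
    ((hasFDerivAt_const x _).prodMk (hasFDerivAt_id _))
  refine h6.fderiv.trans ?_
  ext v
  simp

/-- `Γ.act` is an `mfderiv`, which is meaningful only once differentiability of `Γ.push` at `1` is
known; smoothness of `Φ` in both variables supplies it through a partial derivative of
`chartAction`. -/
theorem push_isDifferentiableRep :
    IsDifferentiableRep (E := E₀) (G := H₀) (V := GroupLieAlgebra 𝓘(ℝ, E₁) H₁) Γ.push Γ.act := by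
  obtain ⟨L, hL, -⟩ := (Γ.contDiffAt_chartAction.of_le ENat.LEInfty.out).hasFDerivAt_fderiv_comp
    (c := fun x => (x, extChartAt 𝓘(ℝ, E₁) (1 : H₁) 1)) (x := extChartAt 𝓘(ℝ, E₀) (1 : H₀) 1)
    ((hasFDerivAt_id _).prodMk (hasFDerivAt_const _ _)) (ContinuousLinearMap.inr ℝ E₀ E₁)
  have hL' : HasFDerivAt (𝕜 := ℝ) (F := GroupLieAlgebra 𝓘(ℝ, E₁) H₁ →L[ℝ] GroupLieAlgebra 𝓘(ℝ, E₁) H₁)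
      (fun x => Γ.push ((extChartAt 𝓘(ℝ, E₀) (1 : H₀)).symm x)) L
      (extChartAt 𝓘(ℝ, E₀) (1 : H₀) 1) := hL.congr_of_eventuallyEq Γ.push_chart_symm
  have e := mfderiv_of_hasFDerivAt_chart hL'
  rw [← e] at hL'
  exact ⟨Γ.push_one, Γ.push_mul, hL'⟩

omit [LieGroup 𝓘(ℝ, E₁) ∞ H₁] in
theorem l1_push (g : H₀) (m : GroupLieAlgebra 𝓘(ℝ, E₁) H₁) :
    Γ.l1 (Γ.push g m) = lieAd g (Γ.l1 m) := by
  have e : (fun x => Γ.Ψ (Γ.Φ g x)) = fun x => g * Γ.Ψ x * g⁻¹ := by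
    funext x; exact Γ.equivariant g x
  have hΨ : MDifferentiable 𝓘(ℝ, E₁) 𝓘(ℝ, E₀) Γ.Ψ := Γ.smooth_Ψ.mdifferentiable (by simp)
  have h1 := mfderiv_comp_of_eq_model (f := Γ.Ψ) (k := Γ.Φ g) (map_one _) (hΨ 1)
    (Γ.mdifferentiable_Φ g 1)
  have h2 := mfderiv_comp_of_eq_model (f := fun x : H₀ => g * x * g⁻¹) (k := Γ.Ψ) (map_one _)
    (mdifferentiable_conj g 1) (hΨ 1)
  rw [e] at h1
  exact congrArg (fun L : E₁ →L[ℝ] E₀ => L m) (h1.symm.trans h2)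

/-- The derivative of `l1_push` in `g` at `1`. -/
theorem l1_act [FiniteDimensional ℝ E₀] (u : GroupLieAlgebra 𝓘(ℝ, E₀) H₀)
    (m : GroupLieAlgebra 𝓘(ℝ, E₁) H₁) : Γ.l1 (Γ.act u m) = Γ.l2 u (Γ.l1 m) := by
  have h1 := Γ.l1.hasFDerivAt.comp _
    (Γ.push_isDifferentiableRep.hasFDerivAt.clm_apply (hasFDerivAt_const m _))
  have h2 := (lieAd_isDifferentiableRep (E := E₀) (G := H₀)).hasFDerivAt.clm_apply
    (hasFDerivAt_const (Γ.l1 m) _)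
  have h3 := h1.unique (h2.congr_of_eventuallyEq (Filter.Eventually.of_forall fun x =>
    Γ.l1_push _ m))
  have h4 := congrArg (fun L : E₀ →L[ℝ] GroupLieAlgebra 𝓘(ℝ, E₀) H₀ => L u) h3
  simp only [zero_add, ContinuousLinearMap.comp_zero] at h4
  exact h4

end LieCrossedModule

/-! ### Consequences of the quadratic structure. -/

namespace LieCrossedModule

variable {E₁ E₀ H₁ H₀ : Type*}
  [NormedAddCommGroup E₁] [NormedSpace ℝ E₁] [NormedAddCommGroup E₀] [NormedSpace ℝ E₀]
  [TopologicalSpace H₁] [ChartedSpace E₁ H₁] [Group H₁]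
  [TopologicalSpace H₀] [ChartedSpace E₀ H₀] [Group H₀]
  [LieGroup 𝓘(ℝ, E₁) ∞ H₁] [LieGroup 𝓘(ℝ, E₀) ∞ H₀] [FiniteDimensional ℝ E₀]
  {Γ : LieCrossedModule E₁ E₀ H₁ H₀}
  {S : GroupLieAlgebra 𝓘(ℝ, E₀) H₀ →L[ℝ] GroupLieAlgebra 𝓘(ℝ, E₁) H₁ →L[ℝ] ℝ}

theorem lieBracketCLM_swap (u v : GroupLieAlgebra 𝓘(ℝ, E₀) H₀) :
    lieBracketCLM E₀ H₀ u v = -lieBracketCLM E₀ H₀ v u := by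
  have : CompleteSpace E₀ := FiniteDimensional.complete ℝ E₀
  have : LieGroup 𝓘(ℝ, E₀) (minSmoothness ℝ 3) H₀ := LieGroup.of_le (n := ∞) (by
    rw [minSmoothness_of_isRCLikeNormedField]; exact ENat.LEInfty.out)
  exact (lie_skew u v).symm

theorem lieBracketCLM_leibniz (u v w : GroupLieAlgebra 𝓘(ℝ, E₀) H₀) :
    lieBracketCLM E₀ H₀ u (lieBracketCLM E₀ H₀ v w)
      = lieBracketCLM E₀ H₀ (lieBracketCLM E₀ H₀ u v) w
        + lieBracketCLM E₀ H₀ v (lieBracketCLM E₀ H₀ u w) := by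
  have : CompleteSpace E₀ := FiniteDimensional.complete ℝ E₀
  have : LieGroup 𝓘(ℝ, E₀) (minSmoothness ℝ 3) H₀ := LieGroup.of_le (n := ∞) (by
    rw [minSmoothness_of_isRCLikeNormedField]; exact ENat.LEInfty.out)
  exact leibniz_lie u v w

omit [LieGroup 𝓘(ℝ, E₁) ∞ H₁] in
theorem IsQuadratic.act_eq (hS : Γ.IsQuadratic S) (u v : GroupLieAlgebra 𝓘(ℝ, E₀) H₀)
    (m : GroupLieAlgebra 𝓘(ℝ, E₁) H₁) : S v (Γ.act u m) = -S (Γ.l2 u v) m :=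
  eq_neg_of_add_eq_zero_right (hS.invariant u v m)

omit [LieGroup 𝓘(ℝ, E₁) ∞ H₁] in
theorem IsQuadratic.ext_right (hS : Γ.IsQuadratic S) {m p : GroupLieAlgebra 𝓘(ℝ, E₁) H₁}
    (h : ∀ u, S u m = S u p) : m = p :=
  sub_eq_zero.mp (hS.nondegenerate_right _ fun u => by rw [map_sub, h, sub_self])

/-- By nondegeneracy an identity in `𝔥₁` may be tested against `S w`, and invariance moves the
action onto `w`. Then `act_br` becomes the Jacobi identity in `𝔥₀`, and `act_l1_swap` follows from
the symmetry of `S(𝔩₁ m, p)`. -/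
theorem IsQuadratic.isStrictLieTwoAlgebra (hS : Γ.IsQuadratic S) :
    IsStrictLieTwoAlgebra Γ.l2 Γ.act Γ.l1 where
  br_swap := lieBracketCLM_swap
  l1_act := Γ.l1_act
  act_br u v m := hS.ext_right fun w => by
    have h : Γ.l2 u (Γ.l2 v w) = Γ.l2 (Γ.l2 u v) w + Γ.l2 v (Γ.l2 u w) :=
      lieBracketCLM_leibniz u v w
    simp only [map_sub, hS.act_eq, h, map_add, _root_.add_apply]
    ring
  act_l1_swap m p := hS.ext_right fun w => by
    have h1 : Γ.l2 (Γ.l1 m) w = -Γ.l1 (Γ.act w m) := by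
      rw [Γ.l1_act]; exact lieBracketCLM_swap _ _
    have h2 : Γ.l2 (Γ.l1 p) w = -Γ.l2 w (Γ.l1 p) := lieBracketCLM_swap _ _
    rw [map_neg, hS.act_eq, hS.act_eq, h1, h2]
    simp only [map_neg, _root_.neg_apply, neg_neg]
    rw [hS.l1_symm, hS.act_eq]

/-- The pairing is invariant under the adjoint action of the whole group. -/
theorem IsQuadratic.pairing_invariant (hS : Γ.IsQuadratic S)
    (hcomp : ∀ a : H₀, ∃ g ∈ connectedComponent a,
      ∀ u m, S (lieAd g u) (Γ.push g m) = S u m)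
    (h : H₀) (u : GroupLieAlgebra 𝓘(ℝ, E₀) H₀) (m : GroupLieAlgebra 𝓘(ℝ, E₁) H₁) :
    S (lieAd h u) (Γ.push h m) = S u m := by
  set f : H₀ → ℝ := fun a => S (lieAd a u) (Γ.push a m) with hf
  have hloc : IsLocallyConstant f := by
    rw [IsLocallyConstant.iff_eventually_eq]
    intro a
    set e := extChartAt 𝓘(ℝ, E₀) a with he
    obtain ⟨r, hr, hball⟩ := Metric.mem_nhds_iff.mp
      (extChartAt_target_mem_nhds (I := 𝓘(ℝ, E₀)) a)
    -- Both representations are differentiated through the same Maurer-Cartan value, so the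
    -- derivative of `f` is an instance of `hS.invariant`. On a ball, which is connected, `f` is
    -- therefore constant.
    have hder : ∀ x ∈ Metric.ball (e a) r, HasFDerivAt (fun z => f (e.symm z)) (0 : E₀ →L[ℝ] ℝ) x := by
      intro x hx
      have hg : ContMDiffAt 𝓘(ℝ, E₀) 𝓘(ℝ, E₀) ∞ e.symm x :=
        contMDiffAt_extChartAt_symm a (hball hx)
      obtain ⟨L, hL, hL'⟩ := (lieAd_isDifferentiableRep (E := E₀) (G := H₀)).exists_hasFDerivAt_comp hg
      obtain ⟨K, hK, hK'⟩ := Γ.push_isDifferentiableRep.exists_hasFDerivAt_comp hg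
      have h1 := S.hasFDerivAt_of_bilinear (hL.clm_apply (hasFDerivAt_const u x))
        (hK.clm_apply (hasFDerivAt_const m x))
      refine h1.congr_fderiv ?_
      ext v
      have h2 := hS.invariant (((maurerCartan (E := E₀) (e.symm x)).comp
        (mfderiv 𝓘(ℝ, E₀) 𝓘(ℝ, E₀) e.symm x) : E₀ →L[ℝ] E₀) v) (lieAd (e.symm x) u)
        (Γ.push (e.symm x) m)
      have h5 : S (L v u) (Γ.push (e.symm x) m) + S (lieAd (e.symm x) u) (K v m) = 0 := by
        rw [hL', hK']
        exact h2
      simpa [add_comm] using h5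
    filter_upwards [extChartAt_source_mem_nhds (I := 𝓘(ℝ, E₀)) a,
      (continuousAt_extChartAt (I := 𝓘(ℝ, E₀)) a) (Metric.ball_mem_nhds (e a) hr)] with b hb hb'
    have h1 := Metric.isOpen_ball.is_const_of_fderiv_eq_zero (𝕜 := ℝ)
      (convex_ball (e a) r).isPreconnected
      (fun x hx => (hder x hx).differentiableAt.differentiableWithinAt)
      (fun x hx => (hder x hx).fderiv) hb' (Metric.mem_ball_self hr)
    rwa [e.left_inv hb, e.left_inv (mem_extChartAt_source a)] at h1
  obtain ⟨g, hg, hgS⟩ := hcomp h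
  have h1 : f h = f g := hloc.apply_eq_of_isPreconnected isPreconnected_connectedComponent
    mem_connectedComponent hg
  exact h1.trans (hgS u m)

end LieCrossedModule

/-! ### Passage between forms on the manifold and their chart expressions. -/

section Transport

variable {E M : Type*} [NormedAddCommGroup E] [NormedSpace ℝ E]
  [TopologicalSpace M] [ChartedSpace E M]
  {V W U : Type*} [NormedAddCommGroup V] [NormedSpace ℝ V]
  [NormedAddCommGroup W] [NormedSpace ℝ W] [NormedAddCommGroup U] [NormedSpace ℝ U] {k l : ℕ}

namespace DForm

/-- Tangent spaces at distinct points are distinct as types, though all unfold to `E`. Taking linear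
maps into `E` allows the base point to be changed without casts. -/
theorem comp_congr (α : DForm E M V k) {p q : M} (hpq : p = q) {F : Type*} [NormedAddCommGroup F]
    [NormedSpace ℝ F] {L L' : F →L[ℝ] E} (h : L = L') :
    (α p).compContinuousLinearMap (L : F →L[ℝ] TangentSpace 𝓘(ℝ, E) p)
      = (α q).compContinuousLinearMap (L' : F →L[ℝ] TangentSpace 𝓘(ℝ, E) q) := by
  subst hpq h
  rfl

theorem inChart_wedge (b : V →L[ℝ] W →L[ℝ] U) (α : DForm E M V k) (β : DForm E M W l) (x : M)
    (y : E) : (DForm.wedge b α β).inChart x y = altWedge b (α.inChart x y) (β.inChart x y) :=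
  (altWedge_compContinuousLinearMap b _ _ _).symm

theorem inChart_map (f : M → V →L[ℝ] W) (α : DForm E M V k) (x : M) (y : E) :
    (DForm.map f α).inChart x y = (f ((extChartAt 𝓘(ℝ, E) x).symm y)).compContinuousAlternatingMap
      (α.inChart x y) := rfl

theorem inChart_add (α β : DForm E M V k) (x : M) (y : E) :
    (α + β).inChart x y = α.inChart x y + β.inChart x y := rfl

theorem inChart_sub (α β : DForm E M V k) (x : M) (y : E) :
    (α - β).inChart x y = α.inChart x y - β.inChart x y := rfl

theorem inChart_smul (r : ℝ) (α : DForm E M V k) (x : M) (y : E) :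
    (r • α).inChart x y = r • α.inChart x y := rfl

variable [IsManifold 𝓘(ℝ, E) ∞ M]

theorem mfderiv_extChartAt_symm_self (x : M) :
    (mfderiv 𝓘(ℝ, E) 𝓘(ℝ, E) (extChartAt 𝓘(ℝ, E) x).symm (extChartAt 𝓘(ℝ, E) x x) : E →L[ℝ] E)
      = ContinuousLinearMap.id ℝ E := by
  have : IsManifold 𝓘(ℝ, E) 1 M := IsManifold.of_le (n := ∞) ENat.LEInfty.out
  have h := mfderivWithin_range_extChartAt_symm (I := 𝓘(ℝ, E)) (x := x)
  have hr : Set.range 𝓘(ℝ, E) = Set.univ := by simp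
  rw [hr] at h
  rw [mfderivWithin_univ] at h
  exact h

theorem apply_eq_inChart (α : DForm E M V k) (x : M) :
    (α x : E [⋀^Fin k]→L[ℝ] V) = α.inChart x (extChartAt 𝓘(ℝ, E) x x) :=
  (α.comp_congr (F := E) (extChartAt_to_inv (I := 𝓘(ℝ, E)) x) (mfderiv_extChartAt_symm_self x)).symm

theorem d_apply_eq (α : DForm E M V k) (x : M) :
    α.d x = extDeriv (E := E) (F := V) (α.inChart x) (extChartAt 𝓘(ℝ, E) x x) := by
  have : IsManifold 𝓘(ℝ, E) 1 M := IsManifold.of_le (n := ∞) ENat.LEInfty.out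
  have h : (mfderiv 𝓘(ℝ, E) 𝓘(ℝ, E) (extChartAt 𝓘(ℝ, E) x) x : E →L[ℝ] E)
      = ContinuousLinearMap.id ℝ E := mfderiv_extChartAt_self
  have key : ∀ η : E [⋀^Fin (k + 1)]→L[ℝ] V, ∀ L : E →L[ℝ] E, L = ContinuousLinearMap.id ℝ E →
      η.compContinuousLinearMap L = η := by
    rintro η _ rfl
    rfl
  exact key _ _ h

/-- `DForm.d` uses a different chart at each point, whereas differentiating `B'` requires `dφ` on a
whole neighbourhood in one chart. The two agree because the exterior derivative commutes with
pullback along the transition map `τ`. -/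
theorem inChart_d {α : DForm E M V k} (hα : α.IsSmooth) (x : M) {y : E}
    (hy : y ∈ (extChartAt 𝓘(ℝ, E) x).target) : α.d.inChart x y = extDeriv (α.inChart x) y := by
  have : IsManifold 𝓘(ℝ, E) 1 M := IsManifold.of_le (n := ∞) ENat.LEInfty.out
  set e := extChartAt 𝓘(ℝ, E) x with he
  set z := e.symm y with hz
  set e' := extChartAt 𝓘(ℝ, E) z with he'
  set τ : E → E := fun t => e' (e.symm t) with hτ
  have hs : ∀ t ∈ e.target, MDifferentiableAt 𝓘(ℝ, E) 𝓘(ℝ, E) e.symm t := fun t ht =>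
    (contMDiffAt_extChartAt_symm x ht).mdifferentiableAt (by simp)
  have hτs : ContDiffAt ℝ ∞ τ y := by
    rw [← contMDiffAt_iff_contDiffAt]
    exact (contMDiffAt_extChartAt (I := 𝓘(ℝ, E)) (n := ∞) (x := z)).comp y
      (contMDiffAt_extChartAt_symm x hy)
  have hτd : ∀ t ∈ e.target, e.symm t ∈ e'.source →
      (fderiv ℝ τ t : E →L[ℝ] E) = (mfderiv 𝓘(ℝ, E) 𝓘(ℝ, E) e' (e.symm t) :
        E →L[ℝ] E).comp (mfderiv 𝓘(ℝ, E) 𝓘(ℝ, E) e.symm t : E →L[ℝ] E) := by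
    intro t ht ht'
    rw [← mfderiv_eq_fderiv]
    rw [he', extChartAt_source] at ht'
    exact mfderiv_comp_of_eq_model (f := e') (k := e.symm) (q := t) rfl
      (mdifferentiableAt_extChartAt ht') (hs t ht)
  have hev : ∀ᶠ t in 𝓝 y, t ∈ e.target ∧ e.symm t ∈ e'.source :=
    Filter.Eventually.and ((isOpen_extChartAt_target x).mem_nhds hy)
      ((contMDiffAt_extChartAt_symm x hy).continuousAt (extChartAt_source_mem_nhds z))
  have heq : α.inChart x =ᶠ[𝓝 y] fun t => (α.inChart z (τ t)).compContinuousLinearMap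
      (fderiv ℝ τ t) := by
    filter_upwards [hev, hev.eventually_nhds] with t ht ht2
    have hτt : τ t ∈ e'.target := e'.map_source ht.2
    have hp : e'.symm (τ t) = e.symm t := e'.left_inv ht.2
    have hd1 : MDifferentiableAt 𝓘(ℝ, E) 𝓘(ℝ, E) e'.symm (τ t) :=
      (contMDiffAt_extChartAt_symm z hτt).mdifferentiableAt (by simp)
    have hτm : MDifferentiableAt 𝓘(ℝ, E) 𝓘(ℝ, E) τ t := by
      have h1 := ht.2
      rw [he', extChartAt_source] at h1
      exact (mdifferentiableAt_extChartAt (I := 𝓘(ℝ, E)) h1).comp t (hs t ht.1)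
    have h2 := mfderiv_comp_of_eq_model (f := e'.symm) (k := τ) (q := t) rfl hd1 hτm
    have h3 : (fun t => e'.symm (τ t)) =ᶠ[𝓝 t] e.symm := ht2.mono fun t' ht' => e'.left_inv ht'.2
    have h4 : (mfderiv 𝓘(ℝ, E) 𝓘(ℝ, E) (fun t => e'.symm (τ t)) t : E →L[ℝ] E)
        = mfderiv 𝓘(ℝ, E) 𝓘(ℝ, E) e.symm t := h3.mfderiv_eq
    have h5 : (mfderiv 𝓘(ℝ, E) 𝓘(ℝ, E) τ t : E →L[ℝ] E) = (fderiv ℝ τ t : E →L[ℝ] E) :=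
      mfderiv_eq_fderiv (E := E) (E' := E) (f := τ) (x := t)
    rw [h5] at h2
    exact α.comp_congr (F := E) hp.symm (h4.symm.trans h2)
  have hL : (mfderiv 𝓘(ℝ, E) 𝓘(ℝ, E) e' z : E →L[ℝ] E).comp
      (mfderiv 𝓘(ℝ, E) 𝓘(ℝ, E) e.symm y : E →L[ℝ] E) = fderiv ℝ τ y :=
    (hτd y hy (mem_extChartAt_source z)).symm
  have hαz : DifferentiableAt ℝ (α.inChart z) (τ y) :=
    ((hα z).contDiffAt (extChartAt_target_mem_nhds z)).differentiableAt (by simp)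
  rw [heq.extDeriv_eq, extDeriv_pullback hαz hτs (by
    rw [minSmoothness_of_isRCLikeNormedField]; exact ENat.LEInfty.out), ← hL]
  rfl

omit [IsManifold 𝓘(ℝ, E) ∞ M] in
theorem IsSmooth.contDiffAt {α : DForm E M V k} (hα : α.IsSmooth) (x : M) :
    ContDiffAt ℝ ∞ (α.inChart x) (extChartAt 𝓘(ℝ, E) x x) :=
  (hα x).contDiffAt (extChartAt_target_mem_nhds x)

end DForm

theorem inChart_pullbackMC {E₀ H₀ : Type*} [NormedAddCommGroup E₀] [NormedSpace ℝ E₀]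
    [TopologicalSpace H₀] [ChartedSpace E₀ H₀] [Group H₀] [IsManifold 𝓘(ℝ, E) ∞ M] {g : M → H₀}
    (hg : ContMDiff 𝓘(ℝ, E) 𝓘(ℝ, E₀) ∞ g) (x : M) {y : E}
    (hy : y ∈ (extChartAt 𝓘(ℝ, E) x).target) :
    (LieCrossedModule.pullbackMC E₀ E g).inChart x y
      = mcForm E₀ (fun z => g ((extChartAt 𝓘(ℝ, E) x).symm z)) y := by
  have h := mfderiv_comp_of_eq_model (f := g) (k := (extChartAt 𝓘(ℝ, E) x).symm) (q := y) rfl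
    (hg.mdifferentiable (by simp) _)
    ((contMDiffAt_extChartAt_symm x hy).mdifferentiableAt (by simp))
  ext v
  exact congrArg (fun L : E →L[ℝ] E₀ => (maurerCartan (E := E₀) (g ((extChartAt 𝓘(ℝ, E) x).symm y)) :
    E₀ →L[ℝ] E₀) (L (v 0))) h.symm

end Transport

/-! ### Gauge invariance on a normed space, then on the manifold. -/

set_option maxHeartbeats 1000000 in
/-- Gauge invariance of the pairing of the fake curvature with the curvature, on a normed space. -/
theorem altWedge_fakeCurvature_curvature_gauge {X V W U : Type*}
    [NormedAddCommGroup X] [NormedSpace ℝ X] [NormedAddCommGroup V] [NormedSpace ℝ V]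
    [NormedAddCommGroup W] [NormedSpace ℝ W] [NormedAddCommGroup U] [NormedSpace ℝ U]
    {br : V →L[ℝ] V →L[ℝ] V} {act : V →L[ℝ] W →L[ℝ] W} {l1 : W →L[ℝ] V} {S : V →L[ℝ] W →L[ℝ] U}
    {θ a A' : X → X [⋀^Fin 1]→L[ℝ] V} {b B' : X → X [⋀^Fin 2]→L[ℝ] W}
    {φ : X → X [⋀^Fin 1]→L[ℝ] W} {y : X} {Q : X → V →L[ℝ] V} {Q' : X →L[ℝ] V →L[ℝ] V}
    {P : X → W →L[ℝ] W} {P' : X →L[ℝ] W →L[ℝ] W}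
    (H : IsStrictLieTwoAlgebra br act l1) (hSact : ∀ u v m, S v (act u m) = -S u (act v m))
    (hQ : HasFDerivAt Q Q' y) (hQ' : ∀ v u, Q' v u = br (θ y ![v]) (Q y u))
    (hQbr : ∀ u v, Q y (br u v) = br (Q y u) (Q y v))
    (hP : HasFDerivAt P P' y) (hP' : ∀ v m, P' v m = act (θ y ![v]) (P y m))
    (hPact : ∀ u m, P y (act u m) = act (Q y u) (P y m))
    (hPl1 : ∀ m, l1 (P y m) = Q y (l1 m)) (hSinv : ∀ u m, S (Q y u) (P y m) = S u m)
    (hθ : DifferentiableAt ℝ θ y)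
    (hdθ : ∀ v w, extDeriv θ y ![v, w] = br (θ y ![v]) (θ y ![w]))
    (ha : DifferentiableAt ℝ a y) (hb : DifferentiableAt ℝ b y) (hφ : ContDiffAt ℝ ∞ φ y)
    (hBd : DifferentiableAt ℝ B' y)
    (hA' : A' =ᶠ[𝓝 y] fun z => (Q z).compContinuousAlternatingMap (a z) - θ z
      - l1.compContinuousAlternatingMap (φ z))
    (hB' : B' =ᶠ[𝓝 y] fun z => (P z).compContinuousAlternatingMap (b z) - extDeriv φ z
      + (1 / 2 : ℝ) • altWedge act (l1.compContinuousAlternatingMap (φ z)) (φ z)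
      - altWedge act ((Q z).compContinuousAlternatingMap (a z)) (φ z)
      + altWedge act (θ z) (φ z)) :
    altWedge S
        (extDeriv A' y + (1 / 2 : ℝ) • altWedge br (A' y) (A' y)
          - l1.compContinuousAlternatingMap (B' y))
        (extDeriv B' y + altWedge act (A' y) (B' y))
      = altWedge S
        (extDeriv a y + (1 / 2 : ℝ) • altWedge br (a y) (a y)
          - l1.compContinuousAlternatingMap (b y))
        (extDeriv b y + altWedge act (a y) (b y)) := by
  -- The connection obtained from the group part alone. The two terms of `B'` involving `Q a` and
  -- `θ` combine into the single term `altWedge act a' φ`, so the rest is a pure shift.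
  set a' : X → X [⋀^Fin 1]→L[ℝ] V := fun z => (Q z).compContinuousAlternatingMap (a z) - θ z
    with ha'
  have hB'' : B' =ᶠ[𝓝 y] fun z => (P z).compContinuousAlternatingMap (b z) - extDeriv φ z
      + (1 / 2 : ℝ) • altWedge act (l1.compContinuousAlternatingMap (φ z)) (φ z)
      - altWedge act (a' z) (φ z) := hB'.mono fun z hz => by
    simp only [hz, ha', altWedge_sub_left]
    abel
  have ha'd : DifferentiableAt ℝ a' y :=
    (hQ.clm_compContinuousAlternatingMap ha.hasFDerivAt).choose_spec.1.differentiableAt.sub hθ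
  have hPb : DifferentiableAt ℝ (fun z => (P z).compContinuousAlternatingMap (b z)) y :=
    (hP.clm_compContinuousAlternatingMap hb.hasFDerivAt).choose_spec.1.differentiableAt
  have hF := fakeCurvature_shift (b := fun z => (P z).compContinuousAlternatingMap (b z)) H ha'd
    (hφ.differentiableAt (by simp)) hA' hB''.eq_of_nhds
  have hC := curvature_shift H ha'd hPb hBd hφ hA'.eq_of_nhds hB''
  -- The fake curvature in the correction term is rewritten as the one of `(A', B')`, so that it
  -- matches the first factor of the pairing and the self-pairing lemma applies.
  rw [← hF, covariantDeriv_gauge hP hP' hPact hb (fun _ => rfl)] at hC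
  have hQF : extDeriv A' y + (1 / 2 : ℝ) • altWedge br (A' y) (A' y)
      - l1.compContinuousAlternatingMap (B' y)
      = (Q y).compContinuousAlternatingMap (extDeriv a y + (1 / 2 : ℝ) • altWedge br (a y) (a y)
        - l1.compContinuousAlternatingMap (b y)) := by
    rw [hF, curvature_gauge H.br_swap hQ hQ' hQbr hθ hdθ ha (fun _ => rfl)]
    ext v
    simp [hPl1]
  rw [hC, altWedge_sub_right, altWedge_self_altWedge_eq_zero S act hSact, sub_zero, hQF,
    altWedge_compContinuousAlternatingMap (h := ContinuousLinearMap.id ℝ U) hSinv]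
  rfl

namespace LieCrossedModule

variable {E₁ E₀ H₁ H₀ E M : Type*}
  [NormedAddCommGroup E₁] [NormedSpace ℝ E₁] [NormedAddCommGroup E₀] [NormedSpace ℝ E₀]
  [TopologicalSpace H₁] [ChartedSpace E₁ H₁] [Group H₁]
  [TopologicalSpace H₀] [ChartedSpace E₀ H₀] [Group H₀]
  [NormedAddCommGroup E] [NormedSpace ℝ E]
  [TopologicalSpace M] [ChartedSpace E M] [IsManifold 𝓘(ℝ, E) ∞ M]
  {Γ : LieCrossedModule E₁ E₀ H₁ H₀}

/-- The equality is stated over `E`, to which the tangent space at `x` unfolds, so that the theorem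
on normed spaces applies. -/
theorem Connection.curv_apply (c : Γ.Connection E M) (x : M) :
    @Eq (E [⋀^Fin 3]→L[ℝ] GroupLieAlgebra 𝓘(ℝ, E₁) H₁) (c.curv x)
      (extDeriv (c.B.inChart x) (extChartAt 𝓘(ℝ, E) x x)
        + altWedge Γ.act (c.A.inChart x (extChartAt 𝓘(ℝ, E) x x))
          (c.B.inChart x (extChartAt 𝓘(ℝ, E) x x))) :=
  congrArg₂ (fun p q : E [⋀^Fin 3]→L[ℝ] GroupLieAlgebra 𝓘(ℝ, E₁) H₁ => p + q)
    (c.B.d_apply_eq x)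
    (congrArg₂ (altWedge (T := E) Γ.act) (c.A.apply_eq_inChart x) (c.B.apply_eq_inChart x))

theorem Connection.fcurv_apply [FiniteDimensional ℝ E₀] [LieGroup 𝓘(ℝ, E₀) ∞ H₀]
    (c : Γ.Connection E M) (x : M) :
    @Eq (E [⋀^Fin 2]→L[ℝ] GroupLieAlgebra 𝓘(ℝ, E₀) H₀) (c.fcurv x)
      (extDeriv (c.A.inChart x) (extChartAt 𝓘(ℝ, E) x x)
        + (1 / 2 : ℝ) • altWedge Γ.l2 (c.A.inChart x (extChartAt 𝓘(ℝ, E) x x))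
          (c.A.inChart x (extChartAt 𝓘(ℝ, E) x x))
        - Γ.l1.compContinuousAlternatingMap (c.B.inChart x (extChartAt 𝓘(ℝ, E) x x))) :=
  congrArg₂ (fun p q : E [⋀^Fin 2]→L[ℝ] GroupLieAlgebra 𝓘(ℝ, E₀) H₀ => p - q)
    (congrArg₂ (fun p q : E [⋀^Fin 2]→L[ℝ] GroupLieAlgebra 𝓘(ℝ, E₀) H₀ => p + (1 / 2 : ℝ) • q)
      (c.A.d_apply_eq x)
      (congrArg₂ (altWedge (T := E) Γ.l2) (c.A.apply_eq_inChart x) (c.A.apply_eq_inChart x)))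
    (congrArg (fun q : E [⋀^Fin 2]→L[ℝ] GroupLieAlgebra 𝓘(ℝ, E₁) H₁ =>
      Γ.l1.compContinuousAlternatingMap q) (c.B.apply_eq_inChart x))

variable {c c' : Γ.Connection E M} {g : M → H₀}
  {φ : DForm E M (GroupLieAlgebra 𝓘(ℝ, E₁) H₁) 1}

theorem IsGaugeTransformation.inChart_A (h : IsGaugeTransformation c c' g φ) (x : M) {y : E}
    (hy : y ∈ (extChartAt 𝓘(ℝ, E) x).target) :
    c'.A.inChart x y
      = (lieAd (g ((extChartAt 𝓘(ℝ, E) x).symm y))).compContinuousAlternatingMap (c.A.inChart x y)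
        - mcForm E₀ (fun z => g ((extChartAt 𝓘(ℝ, E) x).symm z)) y
        - Γ.l1.compContinuousAlternatingMap (φ.inChart x y) := by
  rw [h.A_eq, DForm.inChart_sub, DForm.inChart_sub, DForm.inChart_map, DForm.inChart_map,
    inChart_pullbackMC h.smooth_g x hy]

theorem IsGaugeTransformation.inChart_B (h : IsGaugeTransformation c c' g φ) (x : M) {y : E}
    (hy : y ∈ (extChartAt 𝓘(ℝ, E) x).target) :
    c'.B.inChart x y
      = (Γ.push (g ((extChartAt 𝓘(ℝ, E) x).symm y))).compContinuousAlternatingMap (c.B.inChart x y)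
        - extDeriv (φ.inChart x) y
        + (1 / 2 : ℝ) • altWedge Γ.act (Γ.l1.compContinuousAlternatingMap (φ.inChart x y))
            (φ.inChart x y)
        - altWedge Γ.act ((lieAd (g ((extChartAt 𝓘(ℝ, E) x).symm y))).compContinuousAlternatingMap
            (c.A.inChart x y)) (φ.inChart x y)
        + altWedge Γ.act (mcForm E₀ (fun z => g ((extChartAt 𝓘(ℝ, E) x).symm z)) y)
            (φ.inChart x y) := by
  rw [h.B_eq, DForm.inChart_add, DForm.inChart_sub, DForm.inChart_add, DForm.inChart_sub,
    DForm.inChart_smul, DForm.inChart_wedge, DForm.inChart_wedge, DForm.inChart_wedge,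
    DForm.inChart_map, DForm.inChart_map, DForm.inChart_map, inChart_pullbackMC h.smooth_g x hy,
    DForm.inChart_d h.smooth_φ x hy]

end LieCrossedModule

theorem proposition6
    {E₁ E₀ E H₁ H₀ M : Type*}
    [NormedAddCommGroup E₁] [NormedSpace ℝ E₁] [FiniteDimensional ℝ E₁]
    [NormedAddCommGroup E₀] [NormedSpace ℝ E₀] [FiniteDimensional ℝ E₀]
    [NormedAddCommGroup E] [NormedSpace ℝ E] [FiniteDimensional ℝ E]
    [TopologicalSpace H₁] [ChartedSpace E₁ H₁] [Group H₁] [LieGroup 𝓘(ℝ, E₁) ∞ H₁]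
    [TopologicalSpace H₀] [ChartedSpace E₀ H₀] [Group H₀] [LieGroup 𝓘(ℝ, E₀) ∞ H₀]
    [TopologicalSpace M] [ChartedSpace E M] [IsManifold 𝓘(ℝ, E) ∞ M]
    (Γ : LieCrossedModule E₁ E₀ H₁ H₀)
    (S : GroupLieAlgebra 𝓘(ℝ, E₀) H₀ →L[ℝ] GroupLieAlgebra 𝓘(ℝ, E₁) H₁ →L[ℝ] ℝ)
    (hS : Γ.IsQuadratic S)
    (hcomp : ∀ a : H₀, ∃ g ∈ connectedComponent a,
      ∀ u m, S (lieAd g u) (Γ.push g m) = S u m)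
    (c c' : Γ.Connection E M) (hc : LieCrossedModule.GaugeEquivalent c c') :
    DForm.wedge S c'.fcurv c'.curv = DForm.wedge S c.fcurv c.curv := by
  obtain ⟨g, φ, h⟩ := hc
  funext x
  have hy := mem_extChartAt_target (I := 𝓘(ℝ, E)) x
  have hnhds := extChartAt_target_mem_nhds (I := 𝓘(ℝ, E)) x
  have hg : ContMDiffAt 𝓘(ℝ, E) 𝓘(ℝ, E₀) ∞ (fun z => g ((extChartAt 𝓘(ℝ, E) x).symm z))
      (extChartAt 𝓘(ℝ, E) x x) :=
    h.smooth_g.contMDiffAt.comp _ (contMDiffAt_extChartAt_symm x hy)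
  have hAd := lieAd_isDifferentiableRep (E := E₀) (G := H₀)
  have hpush := Γ.push_isDifferentiableRep
  obtain ⟨Q', hQ, hQ'⟩ := hAd.exists_hasFDerivAt_comp hg
  obtain ⟨P', hP, hP'⟩ := hpush.exists_hasFDerivAt_comp hg
  obtain ⟨hθ, hdθ⟩ := mcForm_structure hg
  have hL := hS.isStrictLieTwoAlgebra
  -- Both sides reduce to the pairing of `m` with a bracket of `u` and `v`, which is antisymmetric.
  have hSact : ∀ u v m, S v (Γ.act u m) = -S u (Γ.act v m) := fun u v m => by
    rw [hS.act_eq, hS.act_eq, hL.br_swap u v, map_neg]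
    simp only [_root_.neg_apply, neg_neg]
  have key := altWedge_fakeCurvature_curvature_gauge (br := Γ.l2) (act := Γ.act) (l1 := Γ.l1) (S := S)
    (θ := mcForm E₀ (fun z => g ((extChartAt 𝓘(ℝ, E) x).symm z)))
    (a := c.A.inChart x) (b := c.B.inChart x) (A' := c'.A.inChart x) (B' := c'.B.inChart x)
    (φ := φ.inChart x) (Q := fun z => lieAd (g ((extChartAt 𝓘(ℝ, E) x).symm z)))
    (P := fun z => Γ.push (g ((extChartAt 𝓘(ℝ, E) x).symm z)))
    hL hSact hQ hQ' (fun u v => (hAd.map_lieAd _ u v).symm) hP hP'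
    (fun u m => (hpush.map_lieAd _ u m).symm)
    (Γ.l1_push _) (hS.pairing_invariant hcomp _) hθ hdθ
    ((c.smooth_A.contDiffAt x).differentiableAt (by simp))
    ((c.smooth_B.contDiffAt x).differentiableAt (by simp)) (h.smooth_φ.contDiffAt x)
    ((c'.smooth_B.contDiffAt x).differentiableAt (by simp))
    (Filter.eventually_of_mem hnhds fun y hy => h.inChart_A x hy)
    (Filter.eventually_of_mem hnhds fun y hy => h.inChart_B x hy)
  exact ((congrArg₂ (altWedge (T := E) S) (c'.fcurv_apply x) (c'.curv_apply x)).trans key).trans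
    (congrArg₂ (altWedge (T := E) S) (c.fcurv_apply x) (c.curv_apply x)).symm
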